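/- **Theorem (12-periodic Lefschetz numbers).** For $n\ge 3$ let $G_n=\overline{C_n}$ be the graph complement of the cyclic graph $C_n$, with vertex set $\mathbb{Z}/n$ (so distinct $x,y$ are adjacent in $G_n$ iff $x-y\neq\pm1$). For a finite simple graph $G$ let $H^k(G)$ be the $k$-th simplicial cohomology, with real coefficients, of its Whitney (clique) complex, and for $T\in\mathrm{Aut}(G)$ let $$\chi(G,T)=\sum_{k}(-1)^k\,\mathrm{tr}\big(T\,|\,H^k(G)\big)$$ be the Lefschetz number of $T$. For an integer $k$ let $r_k(x)=x+k$ and $s_k(x)=k-x$ be the rotations and reflections of $\mathbb{Z}/n$. Then: 1. For every $n\ge3$, $\mathrm{Aut}(G_n)$ has exactly $2n$ elements, and each of them is a rotation or a reflection. 2. The Lefschetz numbers are $12$-periodic in $n$: for all $n\ge3$ and all $k\in\mathbb{Z}$, $\chi(G_{n+12},r_k)=\chi(G_n,r_k)$ and $\chi(G_{n+12},s_k)=\chi(G_n,s_k)$; in particular the set $\{\chi(G_n,T): T\in\mathrm{Aut}(G_n)\}$ of possible Lefschetz numbers is the same for $n$ and $n+12$. 3. Explicitly, for $n\ge 3$ and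 $k\in\mathbb{Z}$, the rotations satisfy: - $\chi(G_n,r_k)=0$ if $n\equiv\pm1 \pmod 6$; - $\chi(G_n,r_k)=2$ for $k$ even and $0$ for $k$ odd, if $n\equiv\pm2\pmod 6$; - $\chi(G_n,r_k)=3$ if $3\mid k$ and $0$ otherwise, if $n\equiv 3\pmod 6$; - $\chi(G_n,r_k)=-1,0,2,3,2,0$ for $k\equiv 0,1,2,3,4,5\pmod 6$ respectively, if $n\equiv0\pmod 6$. 4. The reflections satisfy: - $\chi(G_n,s_k)=0$ if $n\equiv\pm1\pmod{12}$; - $\chi(G_n,s_k)=2$ if $n\equiv\pm5\pmod{12}$; - $\chi(G_n,s_k)=1$ if $3\mid n$; - $\chi(G_n,s_k)=2$ for $k$ even and $0$ for $k$ odd, if $n\equiv2,4\pmod{12}$; - $\chi(G_n,s_k)=0$ for $k$ even and $2$ for $k$ odd, if $n\equiv8,10\pmod{12}$. 5. For $n\ge3$, the average $\frac{1}{|\mathrm{Aut}(G_n)|}\sum_{T\in\mathrm{Aut}(G_n)}\chi(G_n,T)$ equals $0$ if $n\equiv\pm1\pmod{12}$, and equals $1$ for all other $n$. -/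

import Mathlib

namespace CycleComplement

section Cohomology

variable {V : Type*} (G : SimpleGraph V)

/-- Ordered `k`-simplices of the Whitney (clique) complex of `G`: tuples `(x₀, …, x_k)` of
pairwise adjacent (hence pairwise distinct) vertices. -/
abbrev OrderedSimplex (k : ℕ) : Type _ :=
  {x : Fin (k + 1) → V // Pairwise fun i j => G.Adj (x i) (x j)}

variable {G}

/-- Reordering the vertices of an ordered simplex. -/
def OrderedSimplex.reorder {k : ℕ} (x : OrderedSimplex G k) (σ : Equiv.Perm (Fin (k + 1))) :
    OrderedSimplex G k :=
  ⟨fun i => x.1 (σ i), fun _ _ hij => x.2 (σ.injective.ne hij)⟩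

/-- The `i`-th facet of an ordered simplex: the vertex `xᵢ` is deleted. -/
def OrderedSimplex.face {k : ℕ} (x : OrderedSimplex G (k + 1)) (i : Fin (k + 2)) :
    OrderedSimplex G k :=
  ⟨fun j => x.1 (i.succAbove j), fun _ _ hij => x.2 (Fin.succAbove_right_injective.ne hij)⟩

/-- The image of an ordered simplex under a graph automorphism. -/
def OrderedSimplex.image {k : ℕ} (T : G ≃g G) (x : OrderedSimplex G k) : OrderedSimplex G k :=
  ⟨fun i => T (x.1 i), fun _ _ hij => T.map_adj_iff.2 (x.2 hij)⟩

variable (G)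

/-- The space of real `k`-forms: antisymmetric functions on the ordered `k`-simplices. -/
def forms (k : ℕ) : Submodule ℝ (OrderedSimplex G k → ℝ) where
  carrier := {f | ∀ x (σ : Equiv.Perm (Fin (k + 1))),
    f (x.reorder σ) = ((Equiv.Perm.sign σ : ℤ) : ℝ) * f x}
  add_mem' := by
    intro f g hf hg x σ
    simp only [Pi.add_apply, hf x σ, hg x σ, mul_add]
  zero_mem' := by
    intro x σ
    simp
  smul_mem' := by
    intro c f hf x σ
    simp only [Pi.smul_apply, smul_eq_mul, hf x σ]
    ring

/-- The exterior derivative `(df)(x₀, …, x_{k+1}) = ∑ᵢ (-1)ⁱ f(x₀, …, x̂ᵢ, …, x_{k+1})`. -/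
def formDeriv (k : ℕ) : (OrderedSimplex G k → ℝ) →ₗ[ℝ] (OrderedSimplex G (k + 1) → ℝ) where
  toFun f x := ∑ i : Fin (k + 2), (-1 : ℝ) ^ (i : ℕ) * f (x.face i)
  map_add' f g := by
    funext x
    simp only [Pi.add_apply, mul_add, Finset.sum_add_distrib]
  map_smul' c f := by
    funext x
    simp only [Pi.smul_apply, smul_eq_mul, RingHom.id_apply, Finset.mul_sum]
    exact Finset.sum_congr rfl fun i _ => by ring

/-- Closed `k`-forms. -/
def cocycles (k : ℕ) : Submodule ℝ (OrderedSimplex G k → ℝ) :=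
  forms G k ⊓ LinearMap.ker (formDeriv G k)

/-- Exact `k`-forms: `d` of the `(k-1)`-forms, and `0` for `k = 0`. -/
def coboundaries : (k : ℕ) → Submodule ℝ (OrderedSimplex G k → ℝ)
  | 0 => ⊥
  | k + 1 => (forms G k).map (formDeriv G k)

/-- The `k`-th real simplicial cohomology `H^k(G)` of the Whitney complex of `G`: closed forms
modulo exact forms. -/
abbrev Cohomology (k : ℕ) : Type _ :=
  cocycles G k ⧸ (coboundaries G k).submoduleOf (cocycles G k)

variable {G}

/-- The action `f ↦ f ∘ T` of an automorphism on functions of ordered simplices. -/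
def pullback (T : G ≃g G) (k : ℕ) : (OrderedSimplex G k → ℝ) →ₗ[ℝ] (OrderedSimplex G k → ℝ) :=
  LinearMap.funLeft ℝ ℝ (OrderedSimplex.image T)

theorem pullback_mem_forms (T : G ≃g G) (k : ℕ) {f : OrderedSimplex G k → ℝ}
    (hf : f ∈ forms G k) : pullback T k f ∈ forms G k :=
  fun x σ => hf (x.image T) σ

theorem formDeriv_pullback (T : G ≃g G) (k : ℕ) (f : OrderedSimplex G k → ℝ) :
    formDeriv G k (pullback T k f) = pullback T (k + 1) (formDeriv G k f) := rfl

theorem pullback_mem_cocycles (T : G ≃g G) (k : ℕ) :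
    ∀ f ∈ cocycles G k, pullback T k f ∈ cocycles G k := by
  rintro f ⟨hf, hd⟩
  refine ⟨pullback_mem_forms T k hf, ?_⟩
  have hd' : formDeriv G k f = 0 := hd
  change formDeriv G k (pullback T k f) = 0
  rw [formDeriv_pullback, hd', map_zero]

theorem pullback_mem_coboundaries (T : G ≃g G) :
    ∀ (k : ℕ), ∀ f ∈ coboundaries G k, pullback T k f ∈ coboundaries G k
  | 0, f, hf => by
    have h0 : f = 0 := hf
    rw [h0, map_zero]
    exact Submodule.zero_mem _
  | k + 1, _, ⟨g, hg, rfl⟩ => ⟨pullback T k g, pullback_mem_forms T k hg, formDeriv_pullback T k g⟩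

/-- The map induced by an automorphism `T` on `H^k(G)`. -/
def cohomologyMap (T : G ≃g G) (k : ℕ) : Cohomology G k →ₗ[ℝ] Cohomology G k :=
  Submodule.mapQ _ _ ((pullback T k).restrict (pullback_mem_cocycles T k))
    fun f hf => pullback_mem_coboundaries T k f.1 hf

/-- The Lefschetz number `χ(G, T) = ∑ₖ (-1)ᵏ tr(T | H^k(G))` of an automorphism `T` of a finite
graph `G`. There are no `k`-simplices with `k ≥ |V|`, so the sum runs over `k < |V|`. -/
noncomputable def lefschetz (T : G ≃g G) : ℝ :=
  ∑ k ∈ Finset.range (Nat.card V),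
    (-1 : ℝ) ^ k * LinearMap.trace ℝ (Cohomology G k) (cohomologyMap T k)

variable (G)

/-- The average of the Lefschetz numbers over the automorphism group of a finite graph. -/
noncomputable def averageLefschetz : ℝ :=
  (∑ᶠ T : G ≃g G, lefschetz T) / (Nat.card (G ≃g G) : ℝ)

end Cohomology

/-- The cyclic graph `C_n` on `ℤ/n`, with `x` and `y` adjacent iff `x ≠ y` and `x - y = ±1`. -/
def cyclic (n : ℕ) : SimpleGraph (ZMod n) := SimpleGraph.circulantGraph {1}

/-- For `n ≥ 1` this is Mathlib's cycle graph. -/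
theorem cyclic_succ (n : ℕ) : cyclic (n + 1) = SimpleGraph.cycleGraph (n + 1) :=
  (SimpleGraph.cycleGraph_eq_circulantGraph n).symm

/-- The graph complement `G_n` of the cyclic graph `C_n`. -/
def cocyclic (n : ℕ) : SimpleGraph (ZMod n) := (cyclic n)ᶜ

/-- The rotation `x ↦ x + a` of `G_n`. -/
def dihedralRotation (n : ℕ) (a : ZMod n) : cocyclic n ≃g cocyclic n where
  toEquiv := Equiv.addRight a
  map_rel_iff' := by
    intro x y
    simp [cocyclic, cyclic, SimpleGraph.circulantGraph_adj]

/-- The reflection `x ↦ a - x` of `G_n`. -/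
def dihedralReflection (n : ℕ) (a : ZMod n) : cocyclic n ≃g cocyclic n where
  toEquiv := Equiv.subLeft a
  map_rel_iff' := by
    intro x y
    simp [cocyclic, cyclic, SimpleGraph.circulantGraph_adj]
    tauto

end CycleComplement

open CycleComplement

/-! A clique of `G_n` is an independent set of `C_n`. By the Hopf trace formula, `χ(G_n, T)` may be
computed on antisymmetric forms, where an invariant clique `s` with `k + 1` vertices contributes
`(-1)^k` times the sign of `T` on `s`. A cycle of length `l` has sign `(-1)^(l-1)`, so a union of
`j` orbits contributes `-(-1)^j`. With the empty clique included, `1 - χ(G_n, T)` is therefore the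
independence polynomial at `-1` of the quotient of `C_n` by `T`, in which an orbit containing two
neighbours carries a loop and may not be chosen (`one_sub_lefschetz_eq_sum_orbits`).

The quotient by `r_k` is a cycle of length `gcd(n, k)`. The quotient by a reflection is a path: with
a loop at one end for `n` odd, and for `n` even without loops or with loops at both ends, according
to the parity of `k`. Looped vertices can be deleted. At `-1` the independence polynomials of paths
satisfy `a(m+2) = a(m+1) - a(m)`, whose characteristic roots are the primitive sixth roots of unity;
they have period 6 in `m`. The path grows by 6 vertices when `n` grows by 12, whence the period 12.

An automorphism preserves non-adjacency, so `T (x + 1) - T x = ±1`; injectivity and `2 ≠ 0` prevent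
the sign from changing. This leaves only rotations and reflections. The average follows by summing
the explicit values over a period in `k`. -/

namespace CycleComplement

/-! ### The cochain complex and the Hopf trace formula -/

/-- Additivity of the trace along a short exact sequence `0 → A → E → C → 0`. -/
theorem trace_eq_add_of_exact {K A E C : Type*} [Field K]
    [AddCommGroup A] [Module K A] [FiniteDimensional K A]
    [AddCommGroup E] [Module K E] [FiniteDimensional K E]
    [AddCommGroup C] [Module K C] [FiniteDimensional K C]
    (i : A →ₗ[K] E) (q : E →ₗ[K] C) (hi : Function.Injective i) (hq : Function.Surjective q)
    (hqi : LinearMap.ker q = LinearMap.range i)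
    (f : A →ₗ[K] A) (g : E →ₗ[K] E) (h : C →ₗ[K] C)
    (hfg : g ∘ₗ i = i ∘ₗ f) (hgh : q ∘ₗ g = h ∘ₗ q) :
    LinearMap.trace K E g = LinearMap.trace K A f + LinearMap.trace K C h := by
  obtain ⟨r, hr⟩ := LinearMap.exists_leftInverse_of_injective i (LinearMap.ker_eq_bot.2 hi)
  obtain ⟨s, hs⟩ := LinearMap.exists_rightInverse_of_surjective q (LinearMap.range_eq_top.2 hq)
  have hr' : ∀ a, r (i a) = a := fun a => LinearMap.congr_fun hr a
  have hs' : ∀ c, q (s c) = c := fun c => LinearMap.congr_fun hs c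
  have hqi' : ∀ a, q (i a) = 0 := fun a => by
    rw [← LinearMap.mem_ker, hqi]
    exact LinearMap.mem_range_self i a
  -- The correction gives `r ∘ s' = 0`, which makes `i ∘ r` and `s' ∘ q` complementary projections.
  set s' : C →ₗ[K] E := s - i ∘ₗ r ∘ₗ s with hs'def
  have hqs : q ∘ₗ s' = LinearMap.id := by
    ext c
    simp [hs'def, hs', hqi']
  have hsum : i ∘ₗ r + s' ∘ₗ q = LinearMap.id := by
    ext e
    have he : e - s (q e) ∈ LinearMap.range i := by
      rw [← hqi, LinearMap.mem_ker, map_sub, hs', sub_self]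
    obtain ⟨a, ha⟩ := he
    have he' : e = i a + s (q e) := by rw [ha]; abel
    have h1 : i (r e) = i a + i (r (s (q e))) := by
      conv_lhs => rw [he', map_add, map_add, hr']
    simp only [hs'def, LinearMap.add_apply, LinearMap.comp_apply, LinearMap.sub_apply,
      LinearMap.id_apply]
    rw [h1]
    conv_rhs => rw [he']
    abel
  have hg : g = (i ∘ₗ f) ∘ₗ r + (g ∘ₗ s') ∘ₗ q := by
    rw [← hfg, LinearMap.comp_assoc, LinearMap.comp_assoc, ← LinearMap.comp_add, hsum,
      LinearMap.comp_id]
  have h1 : r ∘ₗ i ∘ₗ f = f := by rw [← LinearMap.comp_assoc, hr, LinearMap.id_comp]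
  have h2 : q ∘ₗ g ∘ₗ s' = h := by
    rw [← LinearMap.comp_assoc, hgh, LinearMap.comp_assoc, hqs, LinearMap.comp_id]
  conv_lhs => rw [hg, map_add, LinearMap.trace_comp_comm' r, LinearMap.trace_comp_comm' q,
    h1, h2]

theorem trace_eq_zero_of_subsingleton {K E : Type*} [Field K] [AddCommGroup E] [Module K E]
    [Subsingleton E] (f : E →ₗ[K] E) : LinearMap.trace K E f = 0 := by
  rw [Subsingleton.elim f 0, map_zero]

/-- A permutation `σ` carrying the position `i` to `σ i` induces a permutation of the remaining
positions, whose sign differs from that of `σ` by `(-1) ^ (i + σ i)`. -/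
theorem exists_perm_succAbove {k : ℕ} (σ : Equiv.Perm (Fin (k + 1))) (i : Fin (k + 1)) :
    ∃ τ : Equiv.Perm (Fin k), (∀ m, σ (i.succAbove m) = (σ i).succAbove (τ m)) ∧
      (-1 : ℤ) ^ (i : ℕ) * (Equiv.Perm.sign τ : ℤ) =
        (Equiv.Perm.sign σ : ℤ) * (-1) ^ ((σ i : Fin (k + 1)) : ℕ) := by
  -- `i.cycleRange` moves `i` to `0` and keeps the order of the other positions; its sign is `(-1) ^
  -- i`. Hence `ρ` fixes `0`, and `τ` is its restriction to the successors.
  set ρ : Equiv.Perm (Fin (k + 1)) := (σ i).cycleRange * σ * i.cycleRange⁻¹ with hρ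
  have hinv : ∀ m, i.cycleRange⁻¹ m = i.cycleRange.symm m := fun _ => rfl
  have hρ0 : ρ 0 = 0 := by
    simp [hρ, hinv, Equiv.Perm.mul_apply, Fin.cycleRange_symm_zero]
  obtain ⟨⟨p, τ⟩, hτ⟩ := Equiv.Perm.decomposeFin.symm.surjective ρ
  have hp : p = 0 := by
    rw [← hρ0, ← hτ, Equiv.Perm.decomposeFin_symm_apply_zero]
  subst hp
  refine ⟨τ, fun m => ?_, ?_⟩
  · have h1 : ρ m.succ = (τ m).succ := by
      rw [← hτ, Equiv.Perm.decomposeFin_symm_apply_succ]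
      simp
    rw [hρ, Equiv.Perm.mul_apply, Equiv.Perm.mul_apply, hinv, Fin.cycleRange_symm_succ] at h1
    rw [← Fin.cycleRange_symm_succ (σ i), ← h1, Equiv.symm_apply_apply]
  · have h2 : Equiv.Perm.sign τ = Equiv.Perm.sign ρ := by
      rw [← hτ, Equiv.Perm.decomposeFin.symm_sign]
      simp
    rw [h2, hρ]
    simp only [map_mul, Equiv.Perm.sign_inv, Fin.sign_cycleRange, Units.val_mul,
      Units.val_pow_eq_pow_val, Units.val_neg, Units.val_one]
    have : ((-1 : ℤ) ^ (i : ℕ)) * (-1) ^ (i : ℕ) = 1 := by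
      rw [← mul_pow]; simp
    linear_combination (-1 : ℤ) ^ ((σ i : Fin (k + 1)) : ℕ) * (Equiv.Perm.sign σ : ℤ) * this

variable {V : Type*} {G : SimpleGraph V}

theorem formDeriv_mem_forms (k : ℕ) {f : OrderedSimplex G k → ℝ} (hf : f ∈ forms G k) :
    formDeriv G k f ∈ forms G (k + 1) := by
  intro x σ
  change ∑ i : Fin (k + 2), (-1 : ℝ) ^ (i : ℕ) * f ((x.reorder σ).face i) =
    _ * ∑ i : Fin (k + 2), (-1 : ℝ) ^ (i : ℕ) * f (x.face i)
  rw [← Equiv.sum_comp σ fun i => (-1 : ℝ) ^ (i : ℕ) * f (x.face i), Finset.mul_sum]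
  refine Finset.sum_congr rfl fun i _ => ?_
  obtain ⟨τ, hτ, hs⟩ := exists_perm_succAbove σ i
  have hface : (x.reorder σ).face i = (x.face (σ i)).reorder τ :=
    Subtype.ext (funext fun m => congrArg x.1 (hτ m))
  have hs' := congrArg (Int.cast : ℤ → ℝ) hs
  push_cast at hs'
  rw [hface, hf, ← mul_assoc, ← mul_assoc, hs']

theorem formDeriv_formDeriv (k : ℕ) (f : OrderedSimplex G k → ℝ) :
    formDeriv G (k + 1) (formDeriv G k f) = 0 := by
  funext x
  change ∑ i : Fin (k + 3), (-1 : ℝ) ^ (i : ℕ) *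
    (∑ j : Fin (k + 2), (-1 : ℝ) ^ (j : ℕ) * f ((x.face i).face j)) = 0
  simp only [Finset.mul_sum]
  rw [← Finset.sum_product']
  -- The involution exchanges the order in which two given vertices are deleted; this reverses the
  -- sign.
  refine Finset.sum_involution (fun p _ => (p.1.succAbove p.2, p.2.predAbove p.1)) ?_ ?_ ?_ ?_
  · rintro ⟨i, j⟩ -
    have hface : (x.face (i.succAbove j)).face (j.predAbove i) = (x.face i).face j :=
      Subtype.ext (funext fun m => congrArg x.1
        (Fin.succAbove_succAbove_succAbove_predAbove i j m))
    have hsign := Fin.neg_one_pow_succAbove_add_predAbove (R := ℝ) i j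
    simp only [hface]
    rw [← mul_assoc, ← mul_assoc, ← pow_add, ← pow_add, hsign]
    ring
  · rintro ⟨i, j⟩ - - h
    exact Fin.succAbove_ne i j (congrArg Prod.fst h)
  · simp
  · rintro ⟨i, j⟩ -
    exact Prod.ext (Fin.succAbove_succAbove_predAbove i j) (Fin.predAbove_predAbove_succAbove i j)

theorem coboundaries_le_cocycles (k : ℕ) : coboundaries G k ≤ cocycles G k := by
  cases k with
  | zero => exact bot_le
  | succ k =>
    rintro _ ⟨g, hg, rfl⟩
    exact ⟨formDeriv_mem_forms k hg, formDeriv_formDeriv k g⟩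

theorem cocycles_le_forms (k : ℕ) : cocycles G k ≤ forms G k := inf_le_left

/-- Exactness of `0 → cocycles k → forms k → coboundaries (k + 1) → 0`, where the last map is the
derivative. -/
theorem trace_forms_eq_add [Finite V] (T : G ≃g G) (k : ℕ) :
    LinearMap.trace ℝ (forms G k) ((pullback T k).restrict fun _ => pullback_mem_forms T k) =
      LinearMap.trace ℝ (cocycles G k) ((pullback T k).restrict (pullback_mem_cocycles T k)) +
      LinearMap.trace ℝ (coboundaries G (k + 1))
        ((pullback T (k + 1)).restrict (pullback_mem_coboundaries T (k + 1))) := by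
  refine trace_eq_add_of_exact (Submodule.inclusion (cocycles_le_forms k))
    ((formDeriv G k).restrict fun f hf => Submodule.mem_map_of_mem hf)
    (Submodule.inclusion_injective _) ?_ ?_ _ _ _ rfl rfl
  · rintro ⟨_, f, hf, rfl⟩
    exact ⟨⟨f, hf⟩, rfl⟩
  · ext ⟨f, hf⟩
    rw [Submodule.range_inclusion, LinearMap.mem_ker, Submodule.mem_comap]
    constructor
    · intro h
      exact ⟨hf, congrArg Subtype.val h⟩
    · intro h
      exact Subtype.ext h.2

theorem trace_cocycles_eq_add [Finite V] (T : G ≃g G) (k : ℕ) :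
    LinearMap.trace ℝ (cocycles G k) ((pullback T k).restrict (pullback_mem_cocycles T k)) =
      LinearMap.trace ℝ (coboundaries G k)
        ((pullback T k).restrict (pullback_mem_coboundaries T k)) +
      LinearMap.trace ℝ (Cohomology G k) (cohomologyMap T k) := by
  have hker : LinearMap.ker (((coboundaries G k).submoduleOf (cocycles G k)).mkQ) =
      LinearMap.range (Submodule.inclusion (coboundaries_le_cocycles (G := G) k)) := by
    rw [Submodule.ker_mkQ, Submodule.range_inclusion]
    rfl
  have hcomm : ((coboundaries G k).submoduleOf (cocycles G k)).mkQ ∘ₗ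
      (pullback T k).restrict (pullback_mem_cocycles T k) =
      cohomologyMap T k ∘ₗ ((coboundaries G k).submoduleOf (cocycles G k)).mkQ :=
    LinearMap.ext fun f => rfl
  exact trace_eq_add_of_exact (Submodule.inclusion (coboundaries_le_cocycles k))
    ((coboundaries G k).submoduleOf (cocycles G k)).mkQ
    (Submodule.inclusion_injective _) (Submodule.mkQ_surjective _) hker _ _ _
    (LinearMap.ext fun _ => rfl) hcomm

/-- The Hopf trace formula: the Lefschetz number can be computed on the forms. -/
theorem lefschetz_eq_sum_trace_forms [Finite V] (T : G ≃g G) :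
    lefschetz T = ∑ k ∈ Finset.range (Nat.card V), (-1 : ℝ) ^ k *
      LinearMap.trace ℝ (forms G k) ((pullback T k).restrict fun _ => pullback_mem_forms T k) := by
  set b : ℕ → ℝ := fun k => LinearMap.trace ℝ (coboundaries G k)
    ((pullback T k).restrict (pullback_mem_coboundaries T k)) with hb
  have hb0 : b 0 = 0 := by
    have : Subsingleton (coboundaries G 0) := inferInstanceAs (Subsingleton (⊥ : Submodule ℝ _))
    exact trace_eq_zero_of_subsingleton _
  -- An ordered simplex in this degree would have `|V| + 1` distinct vertices.
  have hbN : b (Nat.card V) = 0 := by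
    have hE : IsEmpty (OrderedSimplex G (Nat.card V)) := by
      refine ⟨fun x => ?_⟩
      have hinj : Function.Injective x.1 := fun i j hij => by
        by_contra h
        exact (x.2 h).ne hij
      have := Nat.card_le_card_of_injective x.1 hinj
      simp at this
    have : Subsingleton (coboundaries G (Nat.card V)) := inferInstance
    exact trace_eq_zero_of_subsingleton _
  -- The traces on coboundaries occur in degrees `k` and `k + 1`, so they telescope in the
  -- alternating sum.
  have key : ∑ k ∈ Finset.range (Nat.card V),
      ((-1 : ℝ) ^ k * b k - (-1) ^ (k + 1) * b (k + 1)) = 0 := by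
    rw [Finset.sum_range_sub' fun k => (-1 : ℝ) ^ k * b k, hb0, hbN]
    simp
  rw [lefschetz, ← add_zero (Finset.sum _ _), ← key, ← Finset.sum_add_distrib]
  refine Finset.sum_congr rfl fun k _ => ?_
  rw [trace_forms_eq_add, trace_cocycles_eq_add]
  simp only [hb]
  ring

end CycleComplement

/-! ### The Lefschetz fixed point formula and its reduction to orbits -/

namespace CycleComplement

variable {V : Type*} {G : SimpleGraph V}

theorem trace_pi_eq_sum {X : Type*} [Fintype X] [DecidableEq X] (L : (X → ℝ) →ₗ[ℝ] (X → ℝ)) :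
    LinearMap.trace ℝ (X → ℝ) L = ∑ x, L (Pi.single x 1) x := by
  rw [LinearMap.trace_eq_matrix_trace ℝ (Pi.basisFun ℝ X), Matrix.trace]
  refine Finset.sum_congr rfl fun x _ => ?_
  simp

theorem OrderedSimplex.injective {k : ℕ} (x : OrderedSimplex G k) : Function.Injective x.1 :=
  fun i j hij => by
    by_contra h
    exact (x.2 h).ne hij

variable (G) in
/-- The projection of the functions on ordered simplices onto the forms. -/
noncomputable def antisymmetrizer (k : ℕ) :
    (OrderedSimplex G k → ℝ) →ₗ[ℝ] (OrderedSimplex G k → ℝ) where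
  toFun f x := ((k + 1).factorial : ℝ)⁻¹ *
    ∑ σ : Equiv.Perm (Fin (k + 1)), ((Equiv.Perm.sign σ : ℤ) : ℝ) * f (x.reorder σ)
  map_add' f g := by
    funext x
    simp only [Pi.add_apply, mul_add, Finset.sum_add_distrib]
  map_smul' c f := by
    funext x
    simp only [Pi.smul_apply, smul_eq_mul, RingHom.id_apply, Finset.mul_sum]
    exact Finset.sum_congr rfl fun i _ => by ring

theorem antisymmetrizer_apply (k : ℕ) (f : OrderedSimplex G k → ℝ) (x : OrderedSimplex G k) :
    antisymmetrizer G k f x = ((k + 1).factorial : ℝ)⁻¹ *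
      ∑ σ : Equiv.Perm (Fin (k + 1)), ((Equiv.Perm.sign σ : ℤ) : ℝ) * f (x.reorder σ) := rfl

theorem sign_mul_sign_self {ι : Type*} [Fintype ι] [DecidableEq ι] (σ : Equiv.Perm ι) :
    ((Equiv.Perm.sign σ : ℤ) : ℝ) * ((Equiv.Perm.sign σ : ℤ) : ℝ) = 1 := by
  rw [← Int.cast_mul, ← Units.val_mul, Int.units_mul_self]
  simp

theorem antisymmetrizer_mem_forms (k : ℕ) (f : OrderedSimplex G k → ℝ) :
    antisymmetrizer G k f ∈ forms G k := by
  intro x σ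
  rw [antisymmetrizer_apply, antisymmetrizer_apply]
  have hsum : ∑ τ : Equiv.Perm (Fin (k + 1)), ((Equiv.Perm.sign τ : ℤ) : ℝ) * f (x.reorder τ) =
      ∑ τ : Equiv.Perm (Fin (k + 1)),
        ((Equiv.Perm.sign (σ * τ) : ℤ) : ℝ) * f ((x.reorder σ).reorder τ) :=
    (Equiv.sum_comp (Equiv.mulLeft σ) fun τ : Equiv.Perm (Fin (k + 1)) =>
      ((Equiv.Perm.sign τ : ℤ) : ℝ) * f (x.reorder τ)).symm
  rw [hsum, mul_left_comm]
  congr 1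
  rw [Finset.mul_sum]
  refine Finset.sum_congr rfl fun τ _ => ?_
  rw [Equiv.Perm.sign_mul]
  push_cast
  linear_combination (-((Equiv.Perm.sign τ : ℤ) : ℝ) * f ((x.reorder σ).reorder τ)) *
    sign_mul_sign_self σ

theorem antisymmetrizer_of_mem_forms (k : ℕ) {f : OrderedSimplex G k → ℝ} (hf : f ∈ forms G k) :
    antisymmetrizer G k f = f := by
  funext x
  rw [antisymmetrizer_apply]
  have h : ∀ τ : Equiv.Perm (Fin (k + 1)),
      ((Equiv.Perm.sign τ : ℤ) : ℝ) * f (x.reorder τ) = f x := fun τ => by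
    rw [hf, ← mul_assoc, sign_mul_sign_self, one_mul]
  simp only [h, Finset.sum_const, Finset.card_univ, Fintype.card_perm, Fintype.card_fin,
    nsmul_eq_mul]
  rw [← mul_assoc, inv_mul_cancel₀ (by positivity), one_mul]

-- The pullback on forms factors through all functions by way of the antisymmetrizer. Cyclicity of
-- the trace moves the computation to the full function space, where the indicator functions form a
-- basis.
open Classical in
theorem trace_forms_eq_sum_reorder {k : ℕ} [Finite V] [Fintype (OrderedSimplex G k)]
    (T : G ≃g G) :
    LinearMap.trace ℝ (forms G k) ((pullback T k).restrict fun _ => pullback_mem_forms T k) =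
      ((k + 1).factorial : ℝ)⁻¹ * ∑ x : OrderedSimplex G k, ∑ σ : Equiv.Perm (Fin (k + 1)),
        if (x.image T).reorder σ = x then ((Equiv.Perm.sign σ : ℤ) : ℝ) else 0 := by
  have h : (pullback T k).restrict (fun _ => pullback_mem_forms T k) =
      ((antisymmetrizer G k).codRestrict (forms G k) (antisymmetrizer_mem_forms k)) ∘ₗ
        (pullback T k ∘ₗ (forms G k).subtype) := by
    ext1 f
    exact Subtype.ext (antisymmetrizer_of_mem_forms k (pullback_mem_forms T k f.2)).symm
  have h2 : (pullback T k ∘ₗ (forms G k).subtype) ∘ₗ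
      ((antisymmetrizer G k).codRestrict (forms G k) (antisymmetrizer_mem_forms k)) =
      pullback T k ∘ₗ antisymmetrizer G k := rfl
  rw [h, LinearMap.trace_comp_comm', h2, trace_pi_eq_sum, Finset.mul_sum]
  refine Finset.sum_congr rfl fun x _ => ?_
  change antisymmetrizer G k _ (x.image T) = _
  rw [antisymmetrizer_apply]
  congr 1
  refine Finset.sum_congr rfl fun σ _ => ?_
  rw [Pi.single_apply, mul_ite, mul_one, mul_zero]

open Classical in
/-- The sign of the permutation induced by `T` on `s` if `s` is invariant, and `0` otherwise. -/
noncomputable def invariantSign (T : Equiv.Perm V) (s : Finset V) : ℝ :=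
  if h : ∀ x, T x ∈ s ↔ x ∈ s then ((Equiv.Perm.sign (T.subtypePerm h) : ℤ) : ℝ) else 0

open Classical in
theorem sum_reorder_eq_invariantSign [Finite V] (T : G ≃g G) {k : ℕ} (x : OrderedSimplex G k) :
    (∑ σ : Equiv.Perm (Fin (k + 1)),
      if (x.image T).reorder σ = x then ((Equiv.Perm.sign σ : ℤ) : ℝ) else 0) =
    invariantSign T.toEquiv (Finset.univ.image x.1) := by
  set s := Finset.univ.image x.1 with hs
  have hmem : ∀ i, x.1 i ∈ s := fun i => Finset.mem_image_of_mem _ (Finset.mem_univ i)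
  rw [invariantSign]
  split_ifs with h
  · set e : Fin (k + 1) ≃ {y // y ∈ s} := Equiv.ofBijective (fun i => ⟨x.1 i, hmem i⟩)
      ⟨fun i j hij => x.injective (congrArg Subtype.val hij), fun ⟨y, hy⟩ => by
        obtain ⟨i, -, hi⟩ := Finset.mem_image.1 hy
        exact ⟨i, Subtype.ext hi⟩⟩ with he
    set τ := Equiv.Perm.subtypePerm T.toEquiv h with hτ
    -- The condition says `τ ∘ e ∘ σ = e`, so exactly one `σ` contributes: the transport of `τ⁻¹`,
    -- which has the sign of `τ`.
    have key : ∀ σ : Equiv.Perm (Fin (k + 1)),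
        (x.image T).reorder σ = x ↔ e.symm.permCongr τ⁻¹ = σ := by
      intro σ
      have h1 : (x.image T).reorder σ = x ↔ ∀ i, τ (e (σ i)) = e i := by
        rw [Subtype.ext_iff, funext_iff]
        refine forall_congr' fun i => ?_
        rw [Subtype.ext_iff]
        rfl
      rw [h1, Equiv.ext_iff]
      refine forall_congr' fun i => ?_
      rw [Equiv.permCongr_apply, Equiv.symm_symm, Equiv.symm_apply_eq, Equiv.Perm.inv_eq_iff_eq,
        eq_comm]
    simp only [key, Finset.sum_ite_eq, Finset.mem_univ, if_true]
    rw [Equiv.Perm.sign_permCongr, Equiv.Perm.sign_inv]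
  · refine Finset.sum_eq_zero fun σ _ => if_neg fun hσ => h ?_
    have hmaps : ∀ y ∈ s, T.toEquiv y ∈ s := by
      intro y hy
      obtain ⟨i, -, rfl⟩ := Finset.mem_image.1 hy
      have h1 : T (x.1 (σ (σ.symm i))) = x.1 (σ.symm i) :=
        congrFun (congrArg Subtype.val hσ) (σ.symm i)
      rw [Equiv.apply_symm_apply] at h1
      change T (x.1 i) ∈ s
      rw [h1]
      exact hmem _
    have himage : s.image T.toEquiv = s := Finset.eq_of_subset_of_card_le
      (Finset.image_subset_iff.2 hmaps)
      (Finset.card_image_of_injective _ T.toEquiv.injective).ge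
    intro y
    refine ⟨fun hy => ?_, hmaps y⟩
    rw [← himage] at hy
    obtain ⟨z, hz, hzy⟩ := Finset.mem_image.1 hy
    rwa [← T.toEquiv.injective hzy]

open Classical in
/-- A clique with `k + 1` elements has `(k + 1)!` orderings. -/
theorem card_orderedSimplex_image_eq {k : ℕ} [Fintype (OrderedSimplex G k)] {s : Finset V}
    (hs : G.IsClique s) (hcard : s.card = k + 1) :
    (Finset.univ.filter fun x : OrderedSimplex G k => Finset.univ.image x.1 = s).card =
      (k + 1).factorial := by
  have e0 : Fin (k + 1) ≃ {y // y ∈ s} := (s.equivFinOfCardEq hcard).symm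
  have hc : Fintype.card (Fin (k + 1) ≃ {y // y ∈ s}) = (k + 1).factorial := by
    rw [Fintype.card_equiv e0, Fintype.card_fin]
  rw [← hc, ← Finset.card_univ]
  symm
  refine Finset.card_bij (fun e _ => ⟨fun i => (e i : V), fun i j hij => hs (e i).2 (e j).2
    fun h => hij (e.injective (Subtype.ext h))⟩) ?_ ?_ ?_
  · intro e _
    refine Finset.mem_filter.2 ⟨Finset.mem_univ _, ?_⟩
    ext y
    simp only [Finset.mem_image, Finset.mem_univ, true_and]
    constructor
    · rintro ⟨i, rfl⟩
      exact (e i).2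
    · intro hy
      exact ⟨e.symm ⟨y, hy⟩, by simp⟩
  · intro e _ e' _ h
    ext i
    exact congrFun (congrArg Subtype.val h) i
  · intro x hx
    have hx' := (Finset.mem_filter.1 hx).2
    have hmem : ∀ i, x.1 i ∈ s := fun i => hx' ▸ Finset.mem_image_of_mem _ (Finset.mem_univ i)
    refine ⟨Equiv.ofBijective (fun i => ⟨x.1 i, hmem i⟩)
      ⟨fun i j hij => x.injective (congrArg Subtype.val hij), fun ⟨y, hy⟩ => ?_⟩,
      Finset.mem_univ _, rfl⟩
    rw [← hx'] at hy
    obtain ⟨i, -, hi⟩ := Finset.mem_image.1 hy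
    exact ⟨i, Subtype.ext hi⟩

-- All `(k + 1)!` orderings of a clique give the same term, which cancels the normalising factor of
-- the antisymmetrizer.
open Classical in
theorem trace_forms_eq_sum_invariantSign [Fintype V] (T : G ≃g G) (k : ℕ) :
    LinearMap.trace ℝ (forms G k) ((pullback T k).restrict fun _ => pullback_mem_forms T k) =
      ∑ s ∈ Finset.univ.powersetCard (k + 1),
        if G.IsClique (s : Set V) then invariantSign T.toEquiv s else 0 := by
  rw [trace_forms_eq_sum_reorder]
  simp only [sum_reorder_eq_invariantSign]
  rw [← Finset.sum_filter, ← Finset.sum_fiberwise_of_maps_to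
    (t := (Finset.univ.powersetCard (k + 1)).filter fun s : Finset V => G.IsClique (s : Set V))
    (g := fun x : OrderedSimplex G k => Finset.univ.image x.1), Finset.mul_sum]
  · refine Finset.sum_congr rfl fun s hs => ?_
    rw [Finset.mem_filter, Finset.mem_powersetCard] at hs
    rw [Finset.sum_congr rfl fun x hx => by rw [(Finset.mem_filter.1 hx).2], Finset.sum_const,
      card_orderedSimplex_image_eq hs.2 hs.1.2, nsmul_eq_mul, ← mul_assoc,
      inv_mul_cancel₀ (by positivity), one_mul]
  · intro x _
    rw [Finset.mem_filter, Finset.mem_powersetCard]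
    refine ⟨⟨Finset.subset_univ _, ?_⟩, ?_⟩
    · rw [Finset.card_image_of_injective _ x.injective, Finset.card_univ, Fintype.card_fin]
    · intro y hy z hz hyz
      simp only [Finset.coe_image, Finset.coe_univ, Set.image_univ, Set.mem_range] at hy hz
      obtain ⟨i, rfl⟩ := hy
      obtain ⟨j, rfl⟩ := hz
      exact x.2 fun h => hyz (h ▸ rfl)

open Classical in
/-- The Lefschetz fixed point formula for the Whitney complex. -/
theorem one_sub_lefschetz_eq_sum [Fintype V] (T : G ≃g G) :
    1 - lefschetz T = ∑ s : Finset V,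
      if G.IsClique (s : Set V) then (-1 : ℝ) ^ s.card * invariantSign T.toEquiv s else 0 := by
  -- The empty clique supplies the `1`. A `k`-simplex has `k + 1` vertices, which accounts for the
  -- minus sign before `lefschetz T`.
  rw [← Finset.powerset_univ, Finset.sum_powerset, Finset.sum_range_succ',
    lefschetz_eq_sum_trace_forms, Finset.card_univ, Nat.card_eq_fintype_card, add_comm]
  have h0 : invariantSign T.toEquiv ∅ = 1 := by
    rw [invariantSign, dif_pos (by simp), Subsingleton.elim (Equiv.Perm.subtypePerm T.toEquiv _) 1]
    simp
  simp only [Finset.powersetCard_zero, Finset.sum_singleton, Finset.coe_empty,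
    SimpleGraph.isClique_empty, if_true, h0, Finset.card_empty, pow_zero, mul_one]
  rw [sub_eq_add_neg, ← Finset.sum_neg_distrib]
  congr 1
  refine Finset.sum_congr rfl fun k _ => ?_
  rw [trace_forms_eq_sum_invariantSign, Finset.mul_sum, ← Finset.sum_neg_distrib]
  refine Finset.sum_congr rfl fun s hs => ?_
  rw [(Finset.mem_powersetCard.1 hs).2]
  split_ifs
  · ring
  · simp

open Classical in
theorem sign_cycleOf_mul_card [Fintype V] (T : Equiv.Perm V) (x : V) :
    ((Equiv.Perm.sign (T.cycleOf x) : ℤ) : ℝ) *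
      (-1) ^ (Finset.univ.filter fun y => T.SameCycle x y).card = -1 := by
  by_cases hx : T x = x
  · have h : (Finset.univ.filter fun y => T.SameCycle x y) = {x} := by
      ext y
      simp only [Finset.mem_filter, Finset.mem_univ, true_and, Finset.mem_singleton]
      constructor
      · intro h
        exact (h.eq_of_left hx).symm
      · rintro rfl
        exact Equiv.Perm.SameCycle.refl _ _
    rw [h, (Equiv.Perm.cycleOf_eq_one_iff T).2 hx]
    simp
  · have h : (Finset.univ.filter fun y => T.SameCycle x y) = (T.cycleOf x).support := by
      ext y
      simp only [Finset.mem_filter, Finset.mem_univ, true_and]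
      rw [Equiv.Perm.mem_support_cycleOf_iff]
      refine ⟨fun h => ⟨h, Equiv.Perm.mem_support.2 hx⟩, fun h => h.1⟩
    rw [h, (T.isCycle_cycleOf hx).sign]
    push_cast
    rw [neg_mul, ← mul_pow]
    simp

-- Each orbit of length `l` contributes `(-1)^l` through the cardinality and `(-1)^(l-1)` through
-- the sign, hence `-1` in total.
open Classical in
theorem neg_one_pow_card_mul_invariantSign [Fintype V] (T : Equiv.Perm V) (π : V → ℕ) {m : ℕ}
    (hsurj : ∀ i < m, ∃ x, π x = i) (horb : ∀ x y, π x = π y ↔ T.SameCycle x y)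
    (t : Finset ℕ) (ht : t ⊆ Finset.range m) :
    (-1 : ℝ) ^ (Finset.univ.filter fun x => π x ∈ t).card *
      invariantSign T (Finset.univ.filter fun x => π x ∈ t) = (-1) ^ t.card := by
  have hT : ∀ x, π (T x) = π x := fun x =>
    (horb _ _).2 (Equiv.Perm.sameCycle_apply_left.2 (Equiv.Perm.SameCycle.refl _ _))
  have hinv : ∀ t : Finset ℕ, ∀ x,
      T x ∈ (Finset.univ.filter fun x => π x ∈ t) ↔ x ∈ (Finset.univ.filter fun x => π x ∈ t) := by
    intro t x
    simp [hT]
  have hsign : ∀ t : Finset ℕ, invariantSign T (Finset.univ.filter fun x => π x ∈ t) =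
      ((Equiv.Perm.sign (Equiv.Perm.ofSubtype (T.subtypePerm (hinv t))) : ℤ) : ℝ) := by
    intro t
    rw [invariantSign, dif_pos (hinv t), Equiv.Perm.sign_ofSubtype]
  induction t using Finset.induction_on with
  | empty =>
    rw [invariantSign, dif_pos (hinv _)]
    have : IsEmpty {x // x ∈ (Finset.univ.filter fun x => π x ∈ (∅ : Finset ℕ))} :=
      ⟨fun x => by simpa using x.2⟩
    rw [Subsingleton.elim (T.subtypePerm _) 1]
    simp
  | insert q t hq ih =>
    obtain ⟨x, hx⟩ := hsurj q (Finset.mem_range.1 (ht (Finset.mem_insert_self _ _)))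
    have ih' := ih ((Finset.subset_insert _ _).trans ht)
    -- Adjoining an orbit multiplies the restricted permutation by the cycle of `T` on that orbit.
    have hmul : Equiv.Perm.ofSubtype (T.subtypePerm (hinv (insert q t))) =
        Equiv.Perm.ofSubtype (T.subtypePerm (hinv t)) * T.cycleOf x := by
      ext y
      rw [Equiv.Perm.mul_apply, Equiv.Perm.cycleOf_apply]
      by_cases hxy : T.SameCycle x y
      · have hy : π y = q := by rw [← hx, (horb _ _).2 hxy]
        rw [if_pos hxy, Equiv.Perm.ofSubtype_apply_of_mem _ (by simp [hy]),
          Equiv.Perm.ofSubtype_apply_of_not_mem _ (by simpa [hT, hy] using hq)]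
        rfl
      · have hy : π y ≠ q := fun h => hxy ((horb _ _).1 (hx.trans h.symm))
        rw [if_neg hxy]
        by_cases hyt : π y ∈ t
        · rw [Equiv.Perm.ofSubtype_apply_of_mem _ (by simp [hyt]),
            Equiv.Perm.ofSubtype_apply_of_mem _ (by simp [hyt])]
          rfl
        · rw [Equiv.Perm.ofSubtype_apply_of_not_mem _ (by simp [hyt, hy]),
            Equiv.Perm.ofSubtype_apply_of_not_mem _ (by simp [hyt])]
    have hunion : (Finset.univ.filter fun y => π y ∈ insert q t) =
        (Finset.univ.filter fun y => π y ∈ t) ∪ (Finset.univ.filter fun y => T.SameCycle x y) := by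
      ext y
      simp only [Finset.mem_filter, Finset.mem_univ, true_and, Finset.mem_insert, Finset.mem_union,
        ← horb, hx, eq_comm (a := q)]
      tauto
    have hdisj : Disjoint (Finset.univ.filter fun y => π y ∈ t)
        (Finset.univ.filter fun y => T.SameCycle x y) := by
      rw [Finset.disjoint_left]
      intro y hy hxy
      simp only [Finset.mem_filter, Finset.mem_univ, true_and, ← horb, hx] at hy hxy
      exact hq (hxy ▸ hy)
    rw [hsign] at ih' ⊢
    rw [hmul, Equiv.Perm.sign_mul, hunion, Finset.card_union_of_disjoint hdisj,
      Finset.card_insert_of_notMem hq, pow_add, pow_succ, ← ih']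
    push_cast
    linear_combination (-1 : ℝ) ^ (Finset.univ.filter fun x => π x ∈ t).card *
      ((Equiv.Perm.sign (Equiv.Perm.ofSubtype (T.subtypePerm (hinv t))) : ℤ) : ℝ) *
      sign_cycleOf_mul_card T x

open Classical in
/-- If the fibres of `π` over `0, …, m - 1` are the orbits of `T`, then the Lefschetz number of `T`
is determined by the sets of orbits whose union is a clique. -/
theorem one_sub_lefschetz_eq_sum_orbits [Fintype V] (T : G ≃g G) (π : V → ℕ) (m : ℕ)
    (hlt : ∀ x, π x < m) (hsurj : ∀ i < m, ∃ x, π x = i)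
    (horb : ∀ x y, π x = π y ↔ Equiv.Perm.SameCycle T.toEquiv x y) :
    1 - lefschetz T = ∑ t ∈ (Finset.range m).powerset,
      if G.IsClique {x | π x ∈ t} then (-1 : ℝ) ^ t.card else 0 := by
  rw [one_sub_lefschetz_eq_sum]
  symm
  refine Finset.sum_of_injOn (fun t => Finset.univ.filter fun x => π x ∈ t) ?_ ?_ ?_ ?_
  · intro t ht t' ht' h
    simp only [Finset.coe_powerset, Set.mem_preimage, Set.mem_powerset_iff, Finset.coe_subset]
      at ht ht'
    have key : ∀ i < m, i ∈ t ↔ i ∈ t' := by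
      intro i hi
      obtain ⟨x, rfl⟩ := hsurj i hi
      simpa using Finset.ext_iff.1 h x
    ext i
    exact ⟨fun hi => (key i (Finset.mem_range.1 (ht hi))).1 hi,
      fun hi => (key i (Finset.mem_range.1 (ht' hi))).2 hi⟩
  · intro t _
    simp
  -- An invariant set is a union of fibres of `π`; every other set contributes `0`.
  · intro s _ hs
    have : invariantSign T.toEquiv s = 0 := by
      rw [invariantSign, dif_neg]
      intro hinv
      refine hs ⟨s.image π, ?_, ?_⟩
      · simp only [Finset.coe_powerset, Set.mem_preimage, Set.mem_powerset_iff, Finset.coe_subset]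
        intro i hi
        obtain ⟨x, -, rfl⟩ := Finset.mem_image.1 hi
        exact Finset.mem_range.2 (hlt x)
      · ext x
        simp only [Finset.mem_filter, Finset.mem_univ, true_and, Finset.mem_image]
        constructor
        · rintro ⟨y, hy, hxy⟩
          obtain ⟨i, rfl⟩ := (horb _ _).1 hxy
          exact ((Equiv.Perm.subtypePerm T.toEquiv hinv ^ i) ⟨y, hy⟩).2 |> fun h => by
            simpa [Equiv.Perm.subtypePerm_zpow] using h
        · exact fun hx => ⟨x, hx, rfl⟩
    simp [this]
  · intro t ht
    have h := neg_one_pow_card_mul_invariantSign T.toEquiv π hsurj horb t (Finset.mem_powerset.1 ht)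
    simp only [h, Finset.coe_filter, Finset.mem_univ, true_and]

end CycleComplement

/-! ### Independence polynomials of paths and cycles at `-1` -/

namespace CycleComplement

open Finset

theorem ite_eq_ite_of_iff {P Q : Prop} {_ : Decidable P} {_ : Decidable Q} (h : P ↔ Q) (a b : ℝ) :
    (if P then a else b) = if Q then a else b := by
  simp only [h]

open Classical in
/-- The independence polynomial at `-1` of the path `0, …, m - 1` whose vertices outside `p` carry
a loop. -/
noncomputable def pathSum (p : ℕ → Prop) (m : ℕ) : ℝ :=
  ∑ t ∈ (range m).powerset, if ∀ i ∈ t, p i ∧ i + 1 ∉ t then (-1 : ℝ) ^ t.card else 0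

open Classical in
/-- The independence polynomial at `-1` of the cycle on `0, …, d - 1`. -/
noncomputable def cycleSum (d : ℕ) : ℝ :=
  ∑ t ∈ (range d).powerset, if ∀ i ∈ t, (i + 1) % d ∉ t then (-1 : ℝ) ^ t.card else 0

theorem sum_powerset_range_succ (m : ℕ) (f : Finset ℕ → ℝ) :
    ∑ t ∈ (range (m + 1)).powerset, f t =
      ∑ t ∈ (range m).powerset, f t + ∑ t ∈ (range m).powerset, f (insert m t) := by
  rw [range_add_one, sum_powerset_insert notMem_range_self]

theorem pathSum_zero (p : ℕ → Prop) : pathSum p 0 = 1 := by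
  simp [pathSum]

open Classical in
theorem pathSum_one (p : ℕ → Prop) : pathSum p 1 = if p 0 then 0 else 1 := by
  rw [pathSum, sum_powerset_range_succ]
  split_ifs <;> simp [*]

theorem pathSum_congr {p q : ℕ → Prop} {m : ℕ} (h : ∀ i < m, p i ↔ q i) :
    pathSum p m = pathSum q m := by
  refine sum_congr rfl fun t ht => ite_eq_ite_of_iff (forall₂_congr fun i hi => ?_) _ _
  rw [h i (mem_range.1 (mem_powerset.1 ht hi))]

-- Split by the last vertex `m + 1`: choosing it requires that it has no loop, excludes `m`, and
-- changes the sign.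
open Classical in
theorem pathSum_succ_succ (p : ℕ → Prop) (m : ℕ) :
    pathSum p (m + 2) = pathSum p (m + 1) - if p (m + 1) then pathSum p m else 0 := by
  rw [pathSum, sum_powerset_range_succ, ← pathSum, sum_powerset_range_succ m, sub_eq_add_neg]
  congr 1
  have h2 : ∀ t ∈ (range m).powerset,
      (if ∀ i ∈ insert (m + 1) (insert m t), p i ∧ i + 1 ∉ insert (m + 1) (insert m t)
        then (-1 : ℝ) ^ (insert (m + 1) (insert m t)).card else 0) = 0 := by
    intro t _
    refine if_neg fun h => (h m (by simp)).2 (by simp)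
  rw [sum_eq_zero h2, add_zero]
  have h1 : ∀ t ∈ (range m).powerset,
      (if ∀ i ∈ insert (m + 1) t, p i ∧ i + 1 ∉ insert (m + 1) t
        then (-1 : ℝ) ^ (insert (m + 1) t).card else 0) =
      if p (m + 1) then -(if ∀ i ∈ t, p i ∧ i + 1 ∉ t then (-1 : ℝ) ^ t.card else 0) else 0 := by
    intro t ht
    have hlt : ∀ i ∈ t, i < m := fun i hi => mem_range.1 (mem_powerset.1 ht hi)
    have hm : m + 1 ∉ t := fun h => by have := hlt _ h; omega
    have hm2 : m + 1 + 1 ∉ t := fun h => by have := hlt _ h; omega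
    rw [card_insert_of_notMem hm, pow_succ]
    have hiff : (∀ i ∈ insert (m + 1) t, p i ∧ i + 1 ∉ insert (m + 1) t) ↔
        p (m + 1) ∧ ∀ i ∈ t, p i ∧ i + 1 ∉ t := by
      rw [forall_mem_insert]
      refine and_congr ?_ (forall₂_congr fun i hi => ?_)
      · simp [hm2]
      · have := hlt i hi
        have h3 : i ≠ m := by omega
        simp [h3]
    simp only [hiff]
    split_ifs <;> simp_all
  rw [sum_congr rfl h1]
  split_ifs
  · rw [sum_neg_distrib, ← pathSum]
  · simp

theorem cycleSum_one : cycleSum 1 = 1 := by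
  rw [cycleSum, sum_powerset_range_succ]
  simp [Nat.mod_one]

-- Split by the vertex `d + 1`. Without it the cycle opens to a path; choosing it excludes both
-- neighbours `d` and `0`, and the latter exclusion is recorded as a loop at `0`.
open Classical in
theorem cycleSum_add_two (d : ℕ) :
    cycleSum (d + 2) = pathSum (fun _ => True) (d + 1) - pathSum (fun i => i ≠ 0) d := by
  rw [cycleSum, sum_powerset_range_succ, sub_eq_add_neg]
  congr 1
  · refine sum_congr rfl fun t ht => ite_eq_ite_of_iff (forall₂_congr fun i hi => ?_) _ _
    have := mem_range.1 (mem_powerset.1 ht hi)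
    rw [Nat.mod_eq_of_lt (by omega), true_and]
  · have h2 : ∀ t ∈ (range d).powerset,
        (if ∀ i ∈ insert (d + 1) (insert d t), (i + 1) % (d + 2) ∉ insert (d + 1) (insert d t)
          then (-1 : ℝ) ^ (insert (d + 1) (insert d t)).card else 0) = 0 := by
      intro t _
      refine if_neg fun h => h d (by simp) ?_
      rw [Nat.mod_eq_of_lt (by omega)]
      simp
    rw [sum_powerset_range_succ, sum_eq_zero h2, add_zero, pathSum, ← sum_neg_distrib]
    refine sum_congr rfl fun t ht => ?_
    have hlt : ∀ i ∈ t, i < d := fun i hi => mem_range.1 (mem_powerset.1 ht hi)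
    have hm : d + 1 ∉ t := fun h => by have := hlt _ h; omega
    rw [card_insert_of_notMem hm, pow_succ]
    have hiff : (∀ i ∈ insert (d + 1) t, (i + 1) % (d + 2) ∉ insert (d + 1) t) ↔
        ∀ i ∈ t, i ≠ 0 ∧ i + 1 ∉ t := by
      rw [forall_mem_insert]
      have h0 : (d + 1 + 1) % (d + 2) = 0 := Nat.mod_self _
      rw [h0, mem_insert, not_or]
      have h3 : ∀ i ∈ t, ((i + 1) % (d + 2) ∉ insert (d + 1) t ↔ i + 1 ∉ t) := by
        intro i hi
        have := hlt i hi
        rw [Nat.mod_eq_of_lt (by omega), mem_insert, not_or]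
        have h4 : i ≠ d := by omega
        simp [h4]
      rw [forall₂_congr h3]
      constructor
      · rintro ⟨⟨-, h⟩, h'⟩ i hi
        exact ⟨fun hi0 => h (hi0 ▸ hi), h' i hi⟩
      · intro h
        exact ⟨⟨by omega, fun h0 => (h 0 h0).1 rfl⟩, fun i hi => (h i hi).2⟩
    simp only [hiff]
    split_ifs <;> simp

/-- The values `1, 0, -1, -1, 0, 1` of the independence polynomials of paths at `-1`. -/
def hexPattern (m : ℕ) : ℤ :=
  if m % 6 = 0 ∨ m % 6 = 5 then 1 else if m % 6 = 1 ∨ m % 6 = 4 then 0 else -1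

theorem hexPattern_succ_succ (m : ℕ) : hexPattern (m + 2) = hexPattern (m + 1) - hexPattern m := by
  have h : m % 6 < 6 := Nat.mod_lt _ (by norm_num)
  simp only [hexPattern, Nat.add_mod m]
  interval_cases m % 6 <;> simp

theorem pathSum_true (m : ℕ) : pathSum (fun _ => True) m = hexPattern m := by
  induction m using Nat.twoStepInduction with
  | zero => simp [pathSum_zero, hexPattern]
  | one => simp [pathSum_one, hexPattern]
  | more m h1 h2 =>
    rw [pathSum_succ_succ, if_pos trivial, h1, h2, hexPattern_succ_succ]
    push_cast
    ring

/-- The looped vertex `0` is never chosen, which leaves a loopless path on `m` vertices. -/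
theorem pathSum_ne_zero (m : ℕ) : pathSum (fun i => i ≠ 0) (m + 1) = hexPattern m := by
  induction m using Nat.twoStepInduction with
  | zero => simp [pathSum_one, hexPattern]
  | one => simp [pathSum_succ_succ, pathSum_one, pathSum_zero, hexPattern]
  | more m h1 h2 =>
    rw [pathSum_succ_succ, if_pos (by omega), h1, h2, hexPattern_succ_succ]
    push_cast
    ring

/-- The value is `ω^d + ω^(-d)` for a primitive sixth root of unity `ω`. The product form separates
the primes 2 and 3, so that for `d = gcd(n, k)` divisibility can be tested on `n` and `k`. -/
theorem cycleSum_eq {d : ℕ} (hd : 0 < d) :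
    cycleSum d = (if 2 ∣ d then -1 else 1) * (if 3 ∣ d then -2 else 1) := by
  obtain rfl | rfl | ⟨e, rfl⟩ : d = 1 ∨ d = 2 ∨ ∃ e, d = e + 3 := by
    by_cases h : d < 3
    · omega
    · exact Or.inr (Or.inr ⟨d - 3, by omega⟩)
  · rw [cycleSum_one]
    norm_num
  · rw [cycleSum_add_two, pathSum_true, pathSum_zero]
    norm_num [hexPattern]
  · rw [cycleSum_add_two, pathSum_true, pathSum_ne_zero]
    have h : e % 6 < 6 := Nat.mod_lt _ (by norm_num)
    have h2 : 2 ∣ e + 3 ↔ e % 6 % 2 = 1 := by omega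
    have h3 : 3 ∣ e + 3 ↔ e % 6 % 3 = 0 := by omega
    simp only [hexPattern, add_assoc, Nat.add_mod e, h2, h3]
    interval_cases e % 6 <;> norm_num

end CycleComplement

namespace CycleComplement

open Finset

/-! ### Rotations: the quotient is a cycle -/

section Rotations

variable {n : ℕ}

theorem isClique_cocyclic_iff (hn : 2 ≤ n) (S : Set (ZMod n)) :
    (cocyclic n).IsClique S ↔ ∀ x ∈ S, x + 1 ∉ S := by
  have : Fact (1 < n) := ⟨hn⟩
  constructor
  · intro h x hx hx1
    have h1 := h hx hx1 (by simp)
    simp [cocyclic, cyclic, SimpleGraph.circulantGraph_adj] at h1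
  · intro h x hx y hy hxy
    simp only [cocyclic, cyclic, SimpleGraph.compl_adj, SimpleGraph.circulantGraph_adj,
      Set.mem_singleton_iff]
    refine ⟨hxy, ?_⟩
    rintro ⟨-, h1 | h1⟩
    · exact h y hy (by rwa [← h1, add_sub_cancel])
    · exact h x hx (by rwa [← h1, add_sub_cancel])

theorem val_add_one_eq_mod (hn : 2 ≤ n) (x : ZMod n) : (x + 1).val = (x.val + 1) % n := by
  have : NeZero n := ⟨by omega⟩
  have : Fact (1 < n) := ⟨hn⟩
  rw [ZMod.val_add, ZMod.val_one]

theorem zpow_dihedralRotation_apply (a : ZMod n) (i : ℤ) (x : ZMod n) :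
    ((dihedralRotation n a).toEquiv ^ i : Equiv.Perm (ZMod n)) x = x + i * a := by
  have hT : ∀ z, (dihedralRotation n a).toEquiv z = z + a := fun _ => rfl
  have hT' : ∀ z, ((dihedralRotation n a).toEquiv : Equiv.Perm (ZMod n))⁻¹ z = z - a :=
    fun z => by rw [Equiv.Perm.inv_eq_iff_eq, hT, sub_add_cancel]
  induction i using Int.induction_on generalizing x with
  | zero => simp
  | succ i ih =>
    rw [zpow_add_one, Equiv.Perm.mul_apply, hT, ih]
    push_cast
    ring
  | pred i ih =>
    rw [zpow_sub_one, Equiv.Perm.mul_apply, hT', ih]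
    push_cast
    ring

theorem sameCycle_dihedralRotation_iff [NeZero n] (k : ℤ) (x y : ZMod n) :
    x.val % Int.gcd n k = y.val % Int.gcd n k ↔
      Equiv.Perm.SameCycle (dihedralRotation n k).toEquiv x y := by
  have h1 : x.val % Int.gcd n k = y.val % Int.gcd n k ↔
      ((Int.gcd n k : ℕ) : ℤ) ∣ (y.val : ℤ) - x.val := Nat.modEq_iff_dvd
  rw [h1]
  constructor
  · rintro ⟨c, hc⟩
    -- By Bézout `gcd(n, k) = n * gcdA + k * gcdB`, and the first summand vanishes in `ZMod n`.
    refine ⟨Int.gcdB n k * c, ?_⟩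
    rw [zpow_dihedralRotation_apply]
    rw [Int.gcd_eq_gcd_ab] at hc
    have h2 := congrArg (Int.cast : ℤ → ZMod n) hc
    push_cast at h2
    simp only [ZMod.natCast_self, zero_mul, zero_add, ZMod.natCast_val, ZMod.cast_id', id] at h2
    push_cast
    linear_combination -h2
  · rintro ⟨i, hi⟩
    rw [zpow_dihedralRotation_apply] at hi
    have h2 : (((y.val : ℤ) - x.val - i * k : ℤ) : ZMod n) = 0 := by
      push_cast
      simp only [ZMod.natCast_val, ZMod.cast_id', id]
      linear_combination -hi
    rw [ZMod.intCast_zmod_eq_zero_iff_dvd] at h2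
    have h3 : ((Int.gcd n k : ℕ) : ℤ) ∣ (y.val : ℤ) - x.val - i * k :=
      (Int.gcd_dvd_left _ _).trans h2
    have h4 : ((Int.gcd n k : ℕ) : ℤ) ∣ i * k := (Int.gcd_dvd_right _ _).mul_left i
    have h5 := dvd_add h3 h4
    rwa [sub_add_cancel] at h5

/-- Since the gcd divides `n`, adding 1 in `ZMod n` descends to residues modulo the gcd. For gcd 1
the quotient is a single looped vertex, in accordance with `cycleSum 1 = 1`. -/
theorem one_sub_lefschetz_dihedralRotation (hn : 2 ≤ n) (k : ℤ) :
    1 - lefschetz (dihedralRotation n k) = cycleSum (Int.gcd n k) := by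
  have : NeZero n := ⟨by omega⟩
  have hd : 0 < Int.gcd n k := Int.gcd_pos_of_ne_zero_left _ (by omega)
  have hdn : Int.gcd n k ∣ n := by
    have := Int.gcd_dvd_left (n : ℤ) k
    exact_mod_cast this
  have hdle : Int.gcd n k ≤ n := Nat.le_of_dvd (by omega) hdn
  have hsurj : ∀ i < Int.gcd n k, ∃ x : ZMod n, x.val % Int.gcd n k = i := fun i hi =>
    ⟨(i : ZMod n), by rw [ZMod.val_cast_of_lt (hi.trans_le hdle), Nat.mod_eq_of_lt hi]⟩
  rw [one_sub_lefschetz_eq_sum_orbits _ (fun x : ZMod n => x.val % Int.gcd n k) (Int.gcd n k)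
    (fun x => Nat.mod_lt _ hd) hsurj (sameCycle_dihedralRotation_iff k), cycleSum]
  refine sum_congr rfl fun t ht => ite_eq_ite_of_iff ?_ _ _
  rw [isClique_cocyclic_iff hn]
  have hstep : ∀ x : ZMod n, (x + 1).val % Int.gcd n k =
      (x.val % Int.gcd n k + 1) % Int.gcd n k := fun x => by
    rw [val_add_one_eq_mod hn, Nat.mod_mod_of_dvd _ hdn, Nat.mod_add_mod]
  simp only [Set.mem_ofPred_eq, hstep]
  constructor
  · intro h i hi
    obtain ⟨x, hx⟩ := hsurj i (mem_range.1 (mem_powerset.1 ht hi))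
    have := h x (hx ▸ hi)
    rwa [hx] at this
  · exact fun h x hx => h _ hx

theorem lefschetz_dihedralRotation (hn : 2 ≤ n) (k : ℤ) :
    lefschetz (dihedralRotation n k) =
      1 - (if 2 ∣ n ∧ 2 ∣ k then -1 else 1) * (if 3 ∣ n ∧ 3 ∣ k then -2 else 1) := by
  have hd : 0 < Int.gcd n k := Int.gcd_pos_of_ne_zero_left _ (by omega)
  have h := one_sub_lefschetz_dihedralRotation hn k
  have hdvd : ∀ p : ℕ, p ∣ Int.gcd n k ↔ p ∣ n ∧ (p : ℤ) ∣ k := fun p => by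
    rw [Int.dvd_gcd_iff]
    norm_cast
  rw [cycleSum_eq hd] at h
  simp only [hdvd] at h
  push_cast at h
  linarith

end Rotations

/-! ### Reflections: the quotient is a path -/

section Reflections

variable {n : ℕ}

theorem sameCycle_dihedralReflection_iff (a x y : ZMod n) :
    Equiv.Perm.SameCycle (dihedralReflection n a).toEquiv x y ↔ y = x ∨ y = a - x := by
  have hT : ∀ z, (dihedralReflection n a).toEquiv z = a - z := fun _ => rfl
  constructor
  · rintro ⟨i, hi⟩
    have hsq : ((dihedralReflection n a).toEquiv : Equiv.Perm (ZMod n)) ^ (2 : ℤ) = 1 := by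
      ext z
      rw [zpow_two, Equiv.Perm.mul_apply, hT, hT, sub_sub_cancel, Equiv.Perm.one_apply]
    obtain ⟨j, rfl | rfl⟩ := Int.even_or_odd' i
    · rw [zpow_mul, hsq, one_zpow] at hi
      exact Or.inl hi.symm
    · rw [zpow_add, zpow_mul, hsq, one_zpow, one_mul, zpow_one] at hi
      exact Or.inr hi.symm
  · rintro (rfl | rfl)
    · exact Equiv.Perm.SameCycle.refl _ _
    · exact ⟨1, by rw [zpow_one, hT]⟩

open Classical in
/-- The Lefschetz number of a reflection, in terms of a function `g` of the position relative to
`c` that separates the orbits of `v ↦ e - v`. -/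
theorem one_sub_lefschetz_dihedralReflection (hn : 2 ≤ n) {a c e : ZMod n} (hae : a = e + 2 * c)
    (g r : ℕ → ℕ) (m : ℕ) (hlt : ∀ v < n, g v < m) (hsurj : ∀ i < m, ∃ v < n, g v = i)
    (hr : ∀ v < n, r v < n ∧ ((r v : ℕ) : ZMod n) = e - v)
    (horb : ∀ v < n, ∀ w < n, g v = g w ↔ w = v ∨ w = r v) :
    1 - lefschetz (dihedralReflection n a) = ∑ t ∈ (range m).powerset,
      if ∀ v < n, g v ∈ t → g ((v + 1) % n) ∉ t then (-1 : ℝ) ^ t.card else 0 := by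
  have : NeZero n := ⟨by omega⟩
  have hval : ∀ v < n, ((v : ZMod n) + c - c).val = v := fun v hv => by
    rw [add_sub_cancel_right, ZMod.val_cast_of_lt hv]
  rw [one_sub_lefschetz_eq_sum_orbits _ (fun x : ZMod n => g (x - c).val) m
    (fun x => hlt _ (ZMod.val_lt _)) ?_ ?_]
  · refine sum_congr rfl fun t ht => ite_eq_ite_of_iff ?_ _ _
    rw [isClique_cocyclic_iff hn]
    have hstep : ∀ x : ZMod n, (x + 1 - c).val = ((x - c).val + 1) % n := fun x => by
      rw [← val_add_one_eq_mod hn]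
      congr 1
      ring
    simp only [Set.mem_ofPred_eq, hstep]
    constructor
    · intro h v hv hgv
      have := h ((v : ZMod n) + c)
      rw [hval v hv] at this
      exact this hgv
    · exact fun h x hx => h _ (ZMod.val_lt _) hx
  · intro i hi
    obtain ⟨v, hv, rfl⟩ := hsurj i hi
    exact ⟨(v : ZMod n) + c, by rw [hval v hv]⟩
  · intro x y
    rw [horb _ (ZMod.val_lt _) _ (ZMod.val_lt _), sameCycle_dihedralReflection_iff]
    obtain ⟨hr1, hr2⟩ := hr (x - c).val (ZMod.val_lt _)
    have hr3 : r (x - c).val = (a - x - c).val := by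
      rw [← ZMod.val_cast_of_lt hr1, hr2]
      simp only [ZMod.natCast_val, ZMod.cast_id', id]
      congr 1
      rw [hae]
      ring
    rw [hr3, (ZMod.val_injective n).eq_iff, (ZMod.val_injective n).eq_iff, sub_left_inj,
      sub_left_inj]

theorem natCast_sub_one_sub {v : ℕ} (hv : v < n) : ((n - 1 - v : ℕ) : ZMod n) = -1 - v := by
  rw [Nat.cast_sub (by omega), Nat.cast_sub (by omega)]
  simp

/-- For `n` odd the orbits of a reflection form a path with a loop at one end. -/
theorem one_sub_lefschetz_dihedralReflection_odd {h : ℕ} (hh : 1 ≤ h) {a c : ZMod (2 * h + 1)}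
    (hac : a = -1 + 2 * c) :
    1 - lefschetz (dihedralReflection (2 * h + 1) a) = pathSum (fun i => i ≠ 0) (h + 1) := by
  -- The orbit `{v, 2h - v}` is labelled by its smaller element. Orbit `0` is `{0, 2h}`, a pair of
  -- neighbours, hence the loop; orbit `h` is the fixed point.
  rw [one_sub_lefschetz_dihedralReflection (by omega) hac
    (fun v => min v (2 * h + 1 - 1 - v)) (fun v => 2 * h + 1 - 1 - v) (h + 1)
    (fun v hv => by omega) (fun i hi => ⟨i, by omega, by omega⟩)
    (fun v hv => ⟨by omega, natCast_sub_one_sub hv⟩) (fun v hv w hw => by omega), pathSum]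
  refine sum_congr rfl fun t ht => ite_eq_ite_of_iff ?_ _ _
  have hlt : ∀ i ∈ t, i < h + 1 := fun i hi => mem_range.1 (mem_powerset.1 ht hi)
  constructor
  · intro H i hi
    have hi' := hlt i hi
    have e1 : min i (2 * h + 1 - 1 - i) = i := by omega
    constructor
    · rintro rfl
      have e2 : min (2 * h) (2 * h + 1 - 1 - 2 * h) = 0 := by omega
      have := H (2 * h) (by omega) (by rwa [e2])
      rw [Nat.mod_self] at this
      exact this (by simpa using hi)
    · intro hi1
      have hi1' := hlt _ hi1
      have e2 : min (i + 1) (2 * h + 1 - 1 - (i + 1)) = i + 1 := by omega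
      have := H i (by omega) (by rwa [e1])
      rw [Nat.mod_eq_of_lt (by omega), e2] at this
      exact this hi1
  · intro H v hv hgv hgw
    by_cases h1 : v + 1 < 2 * h + 1
    · rw [Nat.mod_eq_of_lt h1] at hgw
      by_cases h2 : v < h
      · have e2 : min (v + 1) (2 * h + 1 - 1 - (v + 1)) = min v (2 * h + 1 - 1 - v) + 1 := by omega
        rw [e2] at hgw
        exact (H _ hgv).2 hgw
      · have e2 : min v (2 * h + 1 - 1 - v) = min (v + 1) (2 * h + 1 - 1 - (v + 1)) + 1 := by omega
        rw [e2] at hgv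
        exact (H _ hgw).2 hgv
    · exact (H _ hgv).1 (by omega)

/-- For `n` even the orbits of a reflection without fixed points form a path with loops at both
ends. -/
theorem one_sub_lefschetz_dihedralReflection_even_odd {h : ℕ} (hh : 1 ≤ h) {a c : ZMod (2 * h)}
    (hac : a = -1 + 2 * c) :
    1 - lefschetz (dihedralReflection (2 * h) a) = pathSum (fun i => i ≠ 0 ∧ i ≠ h - 1) h := by
  -- Here both extreme orbits, `{0, 2h - 1}` and `{h - 1, h}`, are pairs of neighbours.
  rw [one_sub_lefschetz_dihedralReflection (by omega) hac
    (fun v => min v (2 * h - 1 - v)) (fun v => 2 * h - 1 - v) h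
    (fun v hv => by omega) (fun i hi => ⟨i, by omega, by omega⟩)
    (fun v hv => ⟨by omega, natCast_sub_one_sub hv⟩) (fun v hv w hw => by omega), pathSum]
  refine sum_congr rfl fun t ht => ite_eq_ite_of_iff ?_ _ _
  have hlt : ∀ i ∈ t, i < h := fun i hi => mem_range.1 (mem_powerset.1 ht hi)
  constructor
  · intro H i hi
    have hi' := hlt i hi
    have e1 : min i (2 * h - 1 - i) = i := by omega
    refine ⟨⟨?_, ?_⟩, ?_⟩
    · rintro rfl
      have e2 : min (2 * h - 1) (2 * h - 1 - (2 * h - 1)) = 0 := by omega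
      have := H (2 * h - 1) (by omega) (by rwa [e2])
      rw [Nat.sub_add_cancel (by omega), Nat.mod_self] at this
      exact this (by simpa using hi)
    · intro hih
      have e2 : min (i + 1) (2 * h - 1 - (i + 1)) = i := by omega
      have := H i (by omega) (by rwa [e1])
      rw [Nat.mod_eq_of_lt (by omega), e2] at this
      exact this hi
    · intro hi1
      have hi1' := hlt _ hi1
      have e2 : min (i + 1) (2 * h - 1 - (i + 1)) = i + 1 := by omega
      have := H i (by omega) (by rwa [e1])
      rw [Nat.mod_eq_of_lt (by omega), e2] at this
      exact this hi1
  · intro H v hv hgv hgw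
    by_cases h1 : v + 1 < 2 * h
    · rw [Nat.mod_eq_of_lt h1] at hgw
      rcases lt_trichotomy (v + 1) h with h2 | h2 | h2
      · have e2 : min (v + 1) (2 * h - 1 - (v + 1)) = min v (2 * h - 1 - v) + 1 := by omega
        rw [e2] at hgw
        exact (H _ hgv).2 hgw
      · exact (H _ hgv).1.2 (by omega)
      · have e2 : min v (2 * h - 1 - v) = min (v + 1) (2 * h - 1 - (v + 1)) + 1 := by omega
        rw [e2] at hgv
        exact (H _ hgw).2 hgv
    · exact (H _ hgv).1.1 (by omega)

/-- For `n` even the orbits of a reflection with two fixed points form a path. -/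
theorem one_sub_lefschetz_dihedralReflection_even_even {h : ℕ} (hh : 1 ≤ h) {a c : ZMod (2 * h)}
    (hac : a = 0 + 2 * c) :
    1 - lefschetz (dihedralReflection (2 * h) a) = pathSum (fun _ => True) (h + 1) := by
  -- The reflection is `v ↦ -v`, with fixed points `0` and `h`. The case `v = 0` is separate because
  -- `2h - 0` is not a reduced residue.
  have hr : ∀ v < 2 * h, (if v = 0 then 0 else 2 * h - v) < 2 * h ∧
      ((if v = 0 then 0 else 2 * h - v : ℕ) : ZMod (2 * h)) = 0 - v := by
    intro v hv
    split_ifs with h0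
    · simpa [h0] using by omega
    · refine ⟨by omega, ?_⟩
      rw [Nat.cast_sub hv.le, ZMod.natCast_self]
  rw [one_sub_lefschetz_dihedralReflection (by omega) hac
    (fun v => min v (2 * h - v)) (fun v => if v = 0 then 0 else 2 * h - v) (h + 1)
    (fun v hv => by omega) (fun i hi => ⟨i, by omega, by omega⟩)
    hr (fun v hv w hw => by split_ifs <;> omega), pathSum]
  refine sum_congr rfl fun t ht => ite_eq_ite_of_iff ?_ _ _
  have hlt : ∀ i ∈ t, i < h + 1 := fun i hi => mem_range.1 (mem_powerset.1 ht hi)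
  constructor
  · intro H i hi
    refine ⟨trivial, fun hi1 => ?_⟩
    have hi1' := hlt _ hi1
    have e1 : min i (2 * h - i) = i := by omega
    have e2 : min (i + 1) (2 * h - (i + 1)) = i + 1 := by omega
    have := H i (by omega) (by rwa [e1])
    rw [Nat.mod_eq_of_lt (by omega), e2] at this
    exact this hi1
  · intro H v hv hgv hgw
    by_cases h2 : v < h
    · rw [Nat.mod_eq_of_lt (by omega)] at hgw
      have e2 : min (v + 1) (2 * h - (v + 1)) = min v (2 * h - v) + 1 := by omega
      rw [e2] at hgw
      exact (H _ hgv).2 hgw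
    · have e2 : min v (2 * h - v) = min ((v + 1) % (2 * h)) (2 * h - (v + 1) % (2 * h)) + 1 := by
        by_cases h1 : v + 1 < 2 * h
        · rw [Nat.mod_eq_of_lt h1]
          omega
        · have h3 : v + 1 = 2 * h := by omega
          rw [h3, Nat.mod_self]
          omega
      rw [e2] at hgv
      exact (H _ hgw).2 hgv

theorem lefschetz_dihedralReflection_odd {h : ℕ} (hh : 1 ≤ h) (k : ℤ) :
    lefschetz (dihedralReflection (2 * h + 1) k) = 1 - hexPattern h := by
  obtain ⟨c, hc⟩ : ∃ c : ZMod (2 * h + 1), (k : ZMod (2 * h + 1)) = -1 + 2 * c := by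
    -- `h + 1` is the inverse of 2 modulo `2h + 1`.
    refine ⟨(((k + 1) * (h + 1) : ℤ) : ZMod (2 * h + 1)), ?_⟩
    have h0 : ((2 * h + 1 : ℕ) : ZMod (2 * h + 1)) = 0 := ZMod.natCast_self _
    push_cast at h0 ⊢
    linear_combination (-(k : ZMod (2 * h + 1)) - 1) * h0
  have := one_sub_lefschetz_dihedralReflection_odd hh hc
  rw [pathSum_ne_zero] at this
  linarith

theorem lefschetz_dihedralReflection_even {h : ℕ} (hh : 2 ≤ h) (k : ℤ) :
    lefschetz (dihedralReflection (2 * h) k) =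
      1 - if Even k then hexPattern (h + 1) else hexPattern (h - 2) := by
  split_ifs with hk
  · obtain ⟨c, rfl⟩ := hk
    have := one_sub_lefschetz_dihedralReflection_even_even (h := h) (by omega)
      (a := ((c + c : ℤ) : ZMod (2 * h))) (c := c) (by push_cast; ring)
    rw [pathSum_true] at this
    linarith
  · obtain ⟨c, rfl⟩ := Int.not_even_iff_odd.1 hk
    have := one_sub_lefschetz_dihedralReflection_even_odd (h := h) (by omega)
      (a := ((2 * c + 1 : ℤ) : ZMod (2 * h))) (c := c + 1) (by push_cast; ring)
    obtain ⟨j, rfl⟩ : ∃ j, h = j + 2 := ⟨h - 2, by omega⟩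
    -- The looped end `h - 1 = j + 1` is dropped by the recursion; the loop at `0` remains.
    rw [pathSum_succ_succ, if_neg (by omega), sub_zero,
      pathSum_congr (q := fun i => i ≠ 0) (fun i hi => by omega), pathSum_ne_zero] at this
    rw [Nat.add_sub_cancel]
    linarith

end Reflections

end CycleComplement

namespace CycleComplement

open Finset

/-! ### The automorphism group is dihedral -/

section Automorphisms

variable {n : ℕ}

theorem two_ne_zero_zmod (hn : 3 ≤ n) : (2 : ZMod n) ≠ 0 := by
  intro h
  have h2 : ((2 : ℕ) : ZMod n) = 0 := by exact_mod_cast h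
  rw [ZMod.natCast_eq_zero_iff] at h2
  have := Nat.le_of_dvd (by norm_num) h2
  omega

theorem cocyclic_adj_iff (x y : ZMod n) :
    (cocyclic n).Adj x y ↔ x ≠ y ∧ x - y ≠ 1 ∧ y - x ≠ 1 := by
  simp only [cocyclic, cyclic, SimpleGraph.compl_adj, SimpleGraph.circulantGraph_adj,
    Set.mem_singleton_iff]
  tauto

theorem automorphism_apply_add_one (hn : 3 ≤ n) (T : cocyclic n ≃g cocyclic n) (x : ZMod n) :
    T (x + 1) - T x = 1 ∨ T (x + 1) - T x = -1 := by
  have : Fact (1 < n) := ⟨by omega⟩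
  have h : ¬ (cocyclic n).Adj (T (x + 1)) (T x) := by
    rw [T.map_adj_iff, cocyclic_adj_iff]
    simp
  have hne : T (x + 1) ≠ T x := T.injective.ne (by simp)
  rw [cocyclic_adj_iff] at h
  by_contra! h'
  refine h ⟨hne, h'.1, fun h2 => h'.2 ?_⟩
  linear_combination -h2

theorem automorphism_apply (hn : 3 ≤ n) (T : cocyclic n ≃g cocyclic n) (x : ZMod n) :
    T x = T 0 + x * (T 1 - T 0) := by
  have : NeZero n := ⟨by omega⟩
  have hstep : ∀ m : ℕ, T ((m : ZMod n) + 1) - T m = T 1 - T 0 := by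
    intro m
    induction m with
    | zero => simp
    | succ m ih =>
      have h1 := automorphism_apply_add_one hn T m
      have h2 := automorphism_apply_add_one hn T ((m : ZMod n) + 1)
      -- Two consecutive steps of opposite sign would return to `T m`, against injectivity.
      have hne : T ((m : ZMod n) + 1 + 1) ≠ T m := by
        refine T.injective.ne fun h => two_ne_zero_zmod hn ?_
        linear_combination h
      push_cast
      rw [← ih]
      rcases h1 with h1 | h1 <;> rcases h2 with h2 | h2
      · rw [h1, h2]
      · exact absurd (by linear_combination h1 + h2) hne
      · exact absurd (by linear_combination h1 + h2) hne
      · rw [h1, h2]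
  have hnat : ∀ m : ℕ, T (m : ZMod n) = T 0 + m * (T 1 - T 0) := by
    intro m
    induction m with
    | zero => simp
    | succ m ih =>
      push_cast
      linear_combination hstep m + ih
  have h := hnat x.val
  rwa [ZMod.natCast_zmod_val] at h

theorem automorphism_eq_rotation_or_reflection (hn : 3 ≤ n) (T : cocyclic n ≃g cocyclic n) :
    (∃ a : ZMod n, T = dihedralRotation n a) ∨ (∃ a : ZMod n, T = dihedralReflection n a) := by
  have h := automorphism_apply_add_one hn T 0
  rw [zero_add] at h
  rcases h with h | h
  · refine Or.inl ⟨T 0, RelIso.ext fun x => ?_⟩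
    change T x = x + T 0
    rw [automorphism_apply hn, h]
    ring
  · refine Or.inr ⟨T 0, RelIso.ext fun x => ?_⟩
    change T x = T 0 - x
    rw [automorphism_apply hn, h]
    ring

theorem bijective_rotation_reflection (hn : 3 ≤ n) :
    Function.Bijective (Sum.elim (dihedralRotation n) (dihedralReflection n)) := by
  have hrot : ∀ a x : ZMod n, dihedralRotation n a x = x + a := fun _ _ => rfl
  have hrefl : ∀ a x : ZMod n, dihedralReflection n a x = a - x := fun _ _ => rfl
  have hne : ∀ a b, dihedralRotation n a ≠ dihedralReflection n b := by
    intro a b h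
    have h0 := DFunLike.congr_fun h 0
    have h1 := DFunLike.congr_fun h 1
    rw [hrot, hrefl] at h0 h1
    exact two_ne_zero_zmod hn (by linear_combination h1 - h0)
  constructor
  · rintro (a | a) (b | b) h
    · have h0 := DFunLike.congr_fun (F := cocyclic n ≃g cocyclic n) h 0
      simp only [Sum.elim_inl, hrot, zero_add] at h0
      rw [h0]
    · exact absurd h (hne a b)
    · exact absurd h.symm (hne b a)
    · have h0 := DFunLike.congr_fun (F := cocyclic n ≃g cocyclic n) h 0
      simp only [Sum.elim_inr, hrefl, sub_zero] at h0
      rw [h0]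
  · intro T
    rcases automorphism_eq_rotation_or_reflection hn T with ⟨a, rfl⟩ | ⟨a, rfl⟩
    · exact ⟨Sum.inl a, rfl⟩
    · exact ⟨Sum.inr a, rfl⟩

theorem card_automorphisms (hn : 3 ≤ n) : Nat.card (cocyclic n ≃g cocyclic n) = 2 * n := by
  have : NeZero n := ⟨by omega⟩
  rw [← Nat.card_eq_of_bijective _ (bijective_rotation_reflection hn), Nat.card_sum, Nat.card_zmod,
    two_mul]

end Automorphisms

/-! ### Explicit values and periodicity -/

section Values

variable {n : ℕ}

theorem lefschetz_dihedralReflection (hn : 3 ≤ n) (k : ℤ) :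
    lefschetz (dihedralReflection n k) = 1 -
      if n % 2 = 1 then hexPattern (n / 2)
      else if Even k then hexPattern (n / 2 + 1) else hexPattern (n / 2 - 2) := by
  obtain ⟨h, rfl | rfl⟩ := Nat.even_or_odd' n
  · rw [lefschetz_dihedralReflection_even (by omega), if_neg (show ¬ 2 * h % 2 = 1 by omega),
      Nat.mul_div_cancel_left _ (by norm_num)]
  · rw [lefschetz_dihedralReflection_odd (by omega), if_pos (by omega)]
    congr 3
    omega

theorem hexPattern_congr {a b : ℕ} (h : a % 6 = b % 6) : hexPattern a = hexPattern b := by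
  rw [hexPattern, hexPattern, h]

theorem lefschetz_dihedralRotation_add_twelve (hn : 3 ≤ n) (k : ℤ) :
    lefschetz (dihedralRotation (n + 12) k) = lefschetz (dihedralRotation n k) := by
  rw [lefschetz_dihedralRotation (by omega), lefschetz_dihedralRotation (by omega)]
  have h2 : 2 ∣ n + 12 ↔ 2 ∣ n := by omega
  have h3 : 3 ∣ n + 12 ↔ 3 ∣ n := by omega
  simp only [h2, h3]

theorem lefschetz_dihedralReflection_add_twelve (hn : 3 ≤ n) (k : ℤ) :
    lefschetz (dihedralReflection (n + 12) k) = lefschetz (dihedralReflection n k) := by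
  rw [lefschetz_dihedralReflection (by omega), lefschetz_dihedralReflection hn]
  by_cases h : n % 2 = 1
  · rw [if_pos h, if_pos (by omega), hexPattern_congr (a := (n + 12) / 2) (b := n / 2) (by omega)]
  · rw [if_neg h, if_neg (by omega),
      hexPattern_congr (a := (n + 12) / 2 + 1) (b := n / 2 + 1) (by omega),
      hexPattern_congr (a := (n + 12) / 2 - 2) (b := n / 2 - 2) (by omega)]

/-- Parametrising by integers `k` makes the value sets for `n` and `n + 12` comparable, although the
automorphism groups differ. -/
theorem range_lefschetz_eq (hn : 3 ≤ n) :
    Set.range (fun T : cocyclic n ≃g cocyclic n => lefschetz T) =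
      Set.range (fun k : ℤ => lefschetz (dihedralRotation n k)) ∪
        Set.range (fun k : ℤ => lefschetz (dihedralReflection n k)) := by
  ext c
  simp only [Set.mem_range, Set.mem_union]
  constructor
  · rintro ⟨T, rfl⟩
    rcases automorphism_eq_rotation_or_reflection hn T with ⟨a, rfl⟩ | ⟨a, rfl⟩
    · obtain ⟨k, rfl⟩ := ZMod.intCast_surjective a
      exact Or.inl ⟨k, rfl⟩
    · obtain ⟨k, rfl⟩ := ZMod.intCast_surjective a
      exact Or.inr ⟨k, rfl⟩
  · rintro (⟨k, rfl⟩ | ⟨k, rfl⟩)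
    · exact ⟨_, rfl⟩
    · exact ⟨_, rfl⟩

theorem lefschetz_dihedralRotation_pattern (hn : 3 ≤ n) (k : ℤ) :
    (n % 6 = 1 ∨ n % 6 = 5 → lefschetz (dihedralRotation n k) = 0) ∧
    (n % 6 = 2 ∨ n % 6 = 4 → lefschetz (dihedralRotation n k) = if Even k then 2 else 0) ∧
    (n % 6 = 3 → lefschetz (dihedralRotation n k) = if 3 ∣ k then 3 else 0) ∧
    (n % 6 = 0 → lefschetz (dihedralRotation n k) =
      if 6 ∣ k then -1 else if 3 ∣ k then 3 else if Even k then 2 else 0) := by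
  rw [lefschetz_dihedralRotation (by omega)]
  simp only [even_iff_two_dvd]
  refine ⟨fun h => ?_, fun h => ?_, fun h => ?_, fun h => ?_⟩
  · rw [if_neg (by omega), if_neg (by omega)]
    norm_num
  · have h2 : 2 ∣ n := by omega
    have h3 : ¬ 3 ∣ n := by omega
    simp only [h2, h3, true_and, false_and, if_false]
    split_ifs <;> norm_num
  · have h2 : ¬ 2 ∣ n := by omega
    have h3 : 3 ∣ n := by omega
    simp only [h2, h3, true_and, false_and, if_false]
    split_ifs <;> norm_num
  · have h2 : 2 ∣ n := by omega
    have h3 : 3 ∣ n := by omega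
    have h6 : 6 ∣ k ↔ 2 ∣ k ∧ 3 ∣ k := by omega
    simp only [h2, h3, h6, true_and]
    by_cases hk2 : 2 ∣ k <;> by_cases hk3 : 3 ∣ k <;> simp only [hk2, hk3] <;> norm_num

theorem lefschetz_dihedralReflection_pattern (hn : 3 ≤ n) (k : ℤ) :
    (n % 12 = 1 ∨ n % 12 = 11 → lefschetz (dihedralReflection n k) = 0) ∧
    (n % 12 = 5 ∨ n % 12 = 7 → lefschetz (dihedralReflection n k) = 2) ∧
    (n % 3 = 0 → lefschetz (dihedralReflection n k) = 1) ∧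
    (n % 12 = 2 ∨ n % 12 = 4 → lefschetz (dihedralReflection n k) = if Even k then 2 else 0) ∧
    (n % 12 = 8 ∨ n % 12 = 10 →
      lefschetz (dihedralReflection n k) = if Even k then 0 else 2) := by
  rw [lefschetz_dihedralReflection hn]
  have h0 : ∀ m, m % 6 = 0 ∨ m % 6 = 5 → hexPattern m = 1 := fun m h => if_pos h
  have h1 : ∀ m, m % 6 = 1 ∨ m % 6 = 4 → hexPattern m = 0 := fun m h => by
    rw [hexPattern, if_neg (by omega), if_pos h]
  have h2 : ∀ m, m % 6 = 2 ∨ m % 6 = 3 → hexPattern m = -1 := fun m h => by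
    rw [hexPattern, if_neg (by omega), if_neg (by omega)]
  refine ⟨fun h => ?_, fun h => ?_, fun h => ?_, fun h => ?_, fun h => ?_⟩
  · rw [if_pos (by omega), h0 _ (by omega)]
    norm_num
  · rw [if_pos (by omega), h2 _ (by omega)]
    norm_num
  · by_cases hodd : n % 2 = 1
    · rw [if_pos hodd, h1 _ (by omega)]
      norm_num
    · rw [if_neg hodd, h1 _ (by omega), h1 _ (by omega)]
      norm_num
  · rw [if_neg (by omega), h2 _ (by omega), h0 _ (by omega)]
    split_ifs <;> norm_num
  · rw [if_neg (by omega), h0 _ (by omega), h2 _ (by omega)]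
    split_ifs <;> norm_num

end Values

/-! ### The average over the automorphism group -/

section Average

variable {n : ℕ}

theorem sum_range_mul_of_periodic (f : ℕ → ℝ) {L : ℕ} (hf : ∀ i, f (i + L) = f i) (q : ℕ) :
    ∑ i ∈ range (L * q), f i = q * ∑ i ∈ range L, f i := by
  have hf' : ∀ q i, f (L * q + i) = f i := by
    intro q
    induction q with
    | zero => simp
    | succ q ih =>
      intro i
      rw [show L * (q + 1) + i = L * q + i + L by ring, hf, ih]
  induction q with
  | zero => simp
  | succ q ih =>
    rw [Nat.mul_succ, sum_range_add, ih]
    simp only [hf']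
    push_cast
    ring

theorem sum_zmod_eq_sum_range [NeZero n] (f : ZMod n → ℝ) :
    ∑ a, f a = ∑ i ∈ range n, f ((i : ℤ) : ZMod n) := by
  refine sum_nbij' ZMod.val (fun i => ((i : ℤ) : ZMod n)) ?_ ?_ ?_ ?_ ?_
  · exact fun a _ => mem_range.2 (ZMod.val_lt a)
  · exact fun i _ => mem_univ _
  · exact fun a _ => by simp
  · intro i hi
    rw [Int.cast_natCast, ZMod.val_cast_of_lt (mem_range.1 hi)]
  · exact fun a _ => by simp

theorem averageLefschetz_cocyclic_eq_sum (hn : 3 ≤ n) :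
    averageLefschetz (cocyclic n) =
      (∑ i ∈ range n, lefschetz (dihedralRotation n ((i : ℤ) : ZMod n)) +
        ∑ i ∈ range n, lefschetz (dihedralReflection n ((i : ℤ) : ZMod n))) / (2 * n) := by
  have : NeZero n := ⟨by omega⟩
  rw [averageLefschetz, card_automorphisms hn,
    ← finsum_comp_equiv (Equiv.ofBijective _ (bijective_rotation_reflection hn)),
    finsum_eq_sum_of_fintype, Fintype.sum_sum_type,
    ← sum_zmod_eq_sum_range fun a => lefschetz (dihedralRotation n a),
    ← sum_zmod_eq_sum_range fun a => lefschetz (dihedralReflection n a)]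
  push_cast
  rfl

/-- Unless `n` is coprime to 6, the values over one period, `2, 0` or `3, 0, 0` or `-1, 0, 2, 3, 2,
0`, have mean 1. -/
theorem sum_lefschetz_dihedralRotation (hn : 3 ≤ n) :
    ∑ i ∈ range n, lefschetz (dihedralRotation n ((i : ℤ) : ZMod n)) =
      if n % 6 = 1 ∨ n % 6 = 5 then 0 else (n : ℝ) := by
  have hpat := fun i : ℕ => lefschetz_dihedralRotation_pattern hn (i : ℤ)
  by_cases h15 : n % 6 = 1 ∨ n % 6 = 5
  · rw [if_pos h15]
    exact sum_eq_zero fun i _ => (hpat i).1 h15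
  rw [if_neg h15]
  by_cases h24 : n % 6 = 2 ∨ n % 6 = 4
  · obtain ⟨q, hq⟩ : ∃ q, n = 2 * q := ⟨n / 2, by omega⟩
    rw [sum_congr rfl fun i _ => (hpat i).2.1 h24]
    conv_lhs => rw [hq]
    rw [sum_range_mul_of_periodic (fun i => if Even (i : ℤ) then (2 : ℝ) else 0)
      (fun i => by simp [parity_simps]), hq]
    norm_num [sum_range_succ]
    ring
  by_cases h3 : n % 6 = 3
  · obtain ⟨q, hq⟩ : ∃ q, n = 3 * q := ⟨n / 3, by omega⟩
    rw [sum_congr rfl fun i _ => (hpat i).2.2.1 h3]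
    conv_lhs => rw [hq]
    rw [sum_range_mul_of_periodic (fun i => if 3 ∣ (i : ℤ) then (3 : ℝ) else 0)
      (fun i => by simp), hq]
    norm_num [sum_range_succ]
    ring
  · have h0 : n % 6 = 0 := by omega
    obtain ⟨q, hq⟩ : ∃ q, n = 6 * q := ⟨n / 6, by omega⟩
    rw [sum_congr rfl fun i _ => (hpat i).2.2.2 h0]
    conv_lhs => rw [hq]
    rw [sum_range_mul_of_periodic (fun i => if 6 ∣ (i : ℤ) then (-1 : ℝ) else
      if 3 ∣ (i : ℤ) then 3 else if Even (i : ℤ) then 2 else 0) (fun i => by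
        have h1 : (6 : ℤ) ∣ ((i + 6 : ℕ) : ℤ) ↔ (6 : ℤ) ∣ (i : ℤ) := by omega
        have h2 : (3 : ℤ) ∣ ((i + 6 : ℕ) : ℤ) ↔ (3 : ℤ) ∣ (i : ℤ) := by omega
        have h3 : (2 : ℤ) ∣ ((i + 6 : ℕ) : ℤ) ↔ (2 : ℤ) ∣ (i : ℤ) := by omega
        simp only [even_iff_two_dvd, h1, h2, h3]), hq]
    simp only [sum_range_succ, range_zero, sum_empty, even_iff_two_dvd]
    norm_num
    ring

theorem sum_lefschetz_dihedralReflection (hn : 3 ≤ n) :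
    ∑ i ∈ range n, lefschetz (dihedralReflection n ((i : ℤ) : ZMod n)) =
      if n % 12 = 1 ∨ n % 12 = 11 then 0
      else if n % 12 = 5 ∨ n % 12 = 7 then 2 * (n : ℝ) else n := by
  have hpat := fun i : ℕ => lefschetz_dihedralReflection_pattern hn (i : ℤ)
  by_cases h1 : n % 12 = 1 ∨ n % 12 = 11
  · rw [if_pos h1]
    exact sum_eq_zero fun i _ => (hpat i).1 h1
  rw [if_neg h1]
  by_cases h5 : n % 12 = 5 ∨ n % 12 = 7
  · rw [if_pos h5, sum_congr rfl fun i _ => (hpat i).2.1 h5]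
    simp [mul_comm]
  rw [if_neg h5]
  by_cases h3 : n % 3 = 0
  · rw [sum_congr rfl fun i _ => (hpat i).2.2.1 h3]
    simp
  obtain ⟨q, hq⟩ : ∃ q, n = 2 * q := ⟨n / 2, by omega⟩
  by_cases h2 : n % 12 = 2 ∨ n % 12 = 4
  · rw [sum_congr rfl fun i _ => (hpat i).2.2.2.1 h2]
    conv_lhs => rw [hq]
    rw [sum_range_mul_of_periodic (fun i => if Even (i : ℤ) then (2 : ℝ) else 0)
      (fun i => by simp [parity_simps]), hq]
    norm_num [sum_range_succ]
    ring
  · rw [sum_congr rfl fun i _ => (hpat i).2.2.2.2 (by omega)]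
    conv_lhs => rw [hq]
    rw [sum_range_mul_of_periodic (fun i => if Even (i : ℤ) then (0 : ℝ) else 2)
      (fun i => by simp [parity_simps]), hq]
    norm_num [sum_range_succ]
    ring

theorem averageLefschetz_cocyclic (hn : 3 ≤ n) :
    averageLefschetz (cocyclic n) = if n % 12 = 1 ∨ n % 12 = 11 then 0 else 1 := by
  have hn0 : (n : ℝ) ≠ 0 := by
    have : n ≠ 0 := by omega
    exact_mod_cast this
  rw [averageLefschetz_cocyclic_eq_sum hn, sum_lefschetz_dihedralRotation hn,
    sum_lefschetz_dihedralReflection hn]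
  by_cases h1 : n % 12 = 1 ∨ n % 12 = 11
  · rw [if_pos (by omega), if_pos h1, if_pos h1]
    simp
  · rw [if_neg h1, if_neg h1]
    -- In this case the rotations sum to `0` and the reflections to `2n`; in the remaining case both
    -- sums are `n`.
    by_cases h5 : n % 12 = 5 ∨ n % 12 = 7
    · rw [if_pos (by omega), if_pos h5]
      field_simp
      ring
    · rw [if_neg (by omega), if_neg h5]
      field_simp
      ring

end Average

end CycleComplement

theorem mainTheorem12 :
    -- `Aut(G_n)` consists of `2n` elements, the rotations and the reflections
    (∀ n : ℕ, 3 ≤ n →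
      Nat.card (cocyclic n ≃g cocyclic n) = 2 * n ∧
      ∀ T : cocyclic n ≃g cocyclic n,
        (∃ a : ZMod n, T = dihedralRotation n a) ∨ (∃ a : ZMod n, T = dihedralReflection n a)) ∧
    -- 12-periodicity in `n`
    (∀ n : ℕ, 3 ≤ n →
      (∀ k : ℤ, lefschetz (dihedralRotation (n + 12) k) = lefschetz (dihedralRotation n k)) ∧
      (∀ k : ℤ, lefschetz (dihedralReflection (n + 12) k) = lefschetz (dihedralReflection n k)) ∧
      Set.range (fun T : cocyclic (n + 12) ≃g cocyclic (n + 12) => lefschetz T) =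
        Set.range (fun T : cocyclic n ≃g cocyclic n => lefschetz T)) ∧
    -- the pattern for the rotations
    (∀ n : ℕ, 3 ≤ n → ∀ k : ℤ,
      (n % 6 = 1 ∨ n % 6 = 5 → lefschetz (dihedralRotation n k) = 0) ∧
      (n % 6 = 2 ∨ n % 6 = 4 → lefschetz (dihedralRotation n k) = if Even k then 2 else 0) ∧
      (n % 6 = 3 → lefschetz (dihedralRotation n k) = if 3 ∣ k then 3 else 0) ∧
      (n % 6 = 0 → lefschetz (dihedralRotation n k) =
        if 6 ∣ k then -1 else if 3 ∣ k then 3 else if Even k then 2 else 0)) ∧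
    -- the pattern for the reflections
    (∀ n : ℕ, 3 ≤ n → ∀ k : ℤ,
      (n % 12 = 1 ∨ n % 12 = 11 → lefschetz (dihedralReflection n k) = 0) ∧
      (n % 12 = 5 ∨ n % 12 = 7 → lefschetz (dihedralReflection n k) = 2) ∧
      (n % 3 = 0 → lefschetz (dihedralReflection n k) = 1) ∧
      (n % 12 = 2 ∨ n % 12 = 4 → lefschetz (dihedralReflection n k) = if Even k then 2 else 0) ∧
      (n % 12 = 8 ∨ n % 12 = 10 → lefschetz (dihedralReflection n k) = if Even k then 0 else 2)) ∧
    -- the average over `Aut(G_n)`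
    (∀ n : ℕ, 3 ≤ n →
      averageLefschetz (cocyclic n) = if n % 12 = 1 ∨ n % 12 = 11 then 0 else 1) := by
  refine ⟨fun n hn => ⟨card_automorphisms hn, automorphism_eq_rotation_or_reflection hn⟩,
    fun n hn => ⟨lefschetz_dihedralRotation_add_twelve hn,
      lefschetz_dihedralReflection_add_twelve hn, ?_⟩,
    fun n hn => lefschetz_dihedralRotation_pattern hn,
    fun n hn => lefschetz_dihedralReflection_pattern hn,
    fun n hn => averageLefschetz_cocyclic hn⟩
  rw [range_lefschetz_eq (by omega), range_lefschetz_eq hn]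
  simp only [lefschetz_dihedralRotation_add_twelve hn, lefschetz_dihedralReflection_add_twelve hn]
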